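/- Let $n\ge 3$ and let $\Gamma_n=\{\lambda\in\mathbb{R}^n:\lambda_i>0 \text{ for all } i\}$. Let $V\subset\mathbb{R}^n$ be an open convex set, invariant under permutations of the coordinates, with nonempty boundary of class $C^1$, whose inner unit normal $\nu(\lambda)$ satisfies $\nu(\lambda)\in\Gamma_n$ and $\nu(\lambda)\cdot\lambda>0$ for every $\lambda\in\partial V$. For a symmetric matrix $M$ let $\lambda(M)$ be the vector of its eigenvalues. Let $\Omega\subset\mathbb{R}^n$ be open. A function $u\in C^0(\Omega)$ is a viscosity solution of $\lambda(D^2u)\in\partial V$ in $\Omega$ if for all $x_0\in\Omega$ and $\psi\in C^2(\Omega)$ with $\psi(x_0)=u(x_0)$: if $u\le\psi$ in $\Omega$ then $\lambda(D^2\psi(x_0))\in\overline V$, and if $u\ge\psi$ in $\Omega$ then $\lambda(D^2\psi(x_0))\in\mathbb{R}^n\setminus V$. Let $D\subset\mathbb{R}^n$ be a smooth, bounded, strictly convex domain, $\varphi\in C^2(\partial D)$, $A$ a real symmetric positive definite $n\times n$ matrix with $\lambda(A)\in\partial V$, and $b\in\mathbb{R}^n$. For $c\in\mathbb{R}$, let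 $(P_c)$ be the problem of finding $u\in C^0(\mathbb{R}^n\setminus D)$ such that $u$ is a viscosity solution of $\lambda(D^2u)\in\partial V$ in $\mathbb{R}^n\setminus\overline D$, $u=\varphi$ on $\partial D$, and $$\lim_{|x|\to\infty}\left|u(x)-\left(\tfrac12x'Ax+b\cdot x+c\right)\right|=0.$$ Suppose that $c_j\to c$ in $\mathbb{R}$ and that, for each $j$, $u_j$ is a solution of $(P_{c_j})$. Then there is a solution $u$ of $(P_c)$. Moreover, $u$ can be taken to be the uniform limit on $\mathbb{R}^n\setminus D$ of a subsequence of $(u_j)$ that is pointwise monotone (nondecreasing or nonincreasing) on $\mathbb{R}^n\setminus D$. -/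

import Mathlib

open Set Filter Topology
open scoped ContDiff

noncomputable section

namespace ExteriorDirichlet

/-- The Euclidean space `ℝⁿ`. -/
abbrev E (n : ℕ) := EuclideanSpace ℝ (Fin n)

/-- `ρ` is a `C^k` defining function of the open set `S` near its boundary point `x`: on the open
neighbourhood `U` of `x` the set `S` is `{ρ > 0}`, and `∇ρ(x) ≠ 0`. -/
structure IsLocalDefiningFunction {n : ℕ} (k : WithTop ℕ∞) (S : Set (E n)) (x : E n)
    (U : Set (E n)) (ρ : E n → ℝ) : Prop where
  isOpen : IsOpen U
  mem : x ∈ U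
  contDiffOn : ContDiffOn ℝ k ρ U
  mem_iff : ∀ y ∈ U, (y ∈ S ↔ 0 < ρ y)
  gradient_ne_zero : gradient ρ x ≠ 0

/-- The boundary of the open set `S` is of class `C^k`. -/
def HasCkBoundary {n : ℕ} (k : WithTop ℕ∞) (S : Set (E n)) : Prop :=
  ∀ x ∈ frontier S, ∃ (U : Set (E n)) (ρ : E n → ℝ), IsLocalDefiningFunction k S x U ρ

/-- `ν` is the inner unit normal of the open set `S` (with `C^1` boundary) at `x ∈ ∂S`: the
normalised gradient of a `C^1` function that is positive exactly on `S` near `x`. -/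
def IsInnerUnitNormal {n : ℕ} (S : Set (E n)) (x ν : E n) : Prop :=
  ∃ (U : Set (E n)) (ρ : E n → ℝ), IsLocalDefiningFunction 1 S x U ρ ∧
    ν = ‖gradient ρ x‖⁻¹ • gradient ρ x

/-- The open positive cone `Γₙ`. -/
def positiveCone (n : ℕ) : Set (E n) := {l | ∀ i, 0 < l i}

/-- The sets `V` defining the equation `λ(D²u) ∈ ∂V`: open, symmetric, convex, with nonempty `C^1`
boundary, whose inner unit normal `ν` satisfies `ν(λ) ∈ Γₙ` and `ν(λ) · λ > 0` on `∂V`. -/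
structure IsAdmissible {n : ℕ} (V : Set (E n)) : Prop where
  isOpen : IsOpen V
  symmetric : ∀ (σ : Equiv.Perm (Fin n)), ∀ l ∈ V, WithLp.toLp 2 (fun i => l (σ i)) ∈ V
  convex : Convex ℝ V
  frontier_nonempty : (frontier V).Nonempty
  boundary : HasCkBoundary 1 V
  normal_pos : ∀ l ∈ frontier V, ∀ ν, IsInnerUnitNormal V l ν → ν ∈ positiveCone n
  normal_inner_pos : ∀ l ∈ frontier V, ∀ ν, IsInnerUnitNormal V l ν → 0 < inner ℝ ν l

/-- `λ(M) ∈ S`: the matrix `M` is symmetric and its vector of eigenvalues (with multiplicity)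
lies in `S`. It is used only for sets `S` that are invariant under permutations of the coordinates,
so the order of the eigenvalues is immaterial. -/
def EigenvaluesIn {n : ℕ} (M : Matrix (Fin n) (Fin n) ℝ) (S : Set (E n)) : Prop :=
  ∃ hM : M.IsHermitian, WithLp.toLp 2 hM.eigenvalues ∈ S

/-- The Hessian matrix `D²ψ(x)` of second partial derivatives. -/
def hessian {n : ℕ} (ψ : E n → ℝ) (x : E n) : Matrix (Fin n) (Fin n) ℝ :=
  Matrix.of fun i j =>
    fderiv ℝ (fderiv ℝ ψ) x (EuclideanSpace.single i 1) (EuclideanSpace.single j 1)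

/-- The Hessian of a `C^2` function is symmetric, so that `EigenvaluesIn (hessian ψ x) S` only
says that the eigenvalue vector is in `S`. -/
theorem hessian_isHermitian {n : ℕ} {Ω : Set (E n)} (hΩ : IsOpen Ω) {ψ : E n → ℝ}
    (hψ : ContDiffOn ℝ 2 ψ Ω) {x : E n} (hx : x ∈ Ω) : (hessian ψ x).IsHermitian := by
  have h : IsSymmSndFDerivAt ℝ ψ x :=
    (hψ.contDiffAt (hΩ.mem_nhds hx)).isSymmSndFDerivAt (by simp)
  ext i j
  simpa [hessian] using h (EuclideanSpace.single j 1) (EuclideanSpace.single i 1)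

/-- Viscosity subsolutions of `λ(D²u) ∈ ∂V` in the open set `Ω`. -/
structure IsViscositySubsolution {n : ℕ} (V Ω : Set (E n)) (u : E n → ℝ) : Prop where
  usc : UpperSemicontinuousOn u Ω
  test : ∀ x₀ ∈ Ω, ∀ ψ : E n → ℝ, ContDiffOn ℝ 2 ψ Ω → u x₀ - ψ x₀ = 0 →
    (∀ x ∈ Ω, u x - ψ x ≤ 0) → EigenvaluesIn (hessian ψ x₀) (closure V)

/-- Viscosity supersolutions of `λ(D²u) ∈ ∂V` in the open set `Ω`. -/
structure IsViscositySupersolution {n : ℕ} (V Ω : Set (E n)) (u : E n → ℝ) : Prop where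
  lsc : LowerSemicontinuousOn u Ω
  test : ∀ x₀ ∈ Ω, ∀ ψ : E n → ℝ, ContDiffOn ℝ 2 ψ Ω → u x₀ - ψ x₀ = 0 →
    (∀ x ∈ Ω, 0 ≤ u x - ψ x) → EigenvaluesIn (hessian ψ x₀) Vᶜ

/-- Viscosity solutions of `λ(D²u) ∈ ∂V` in the open set `Ω`. -/
structure IsViscositySolution {n : ℕ} (V Ω : Set (E n)) (u : E n → ℝ) : Prop where
  continuousOn : ContinuousOn u Ω
  sub : IsViscositySubsolution V Ω u
  super : IsViscositySupersolution V Ω u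

/-- Smooth, bounded, strictly convex domains. Strict convexity is that of the closure: the boundary
contains no segment. -/
structure IsSmoothStrictlyConvexDomain {n : ℕ} (D : Set (E n)) : Prop where
  isOpen : IsOpen D
  isConnected : IsConnected D
  isBounded : Bornology.IsBounded D
  smooth : HasCkBoundary ∞ D
  strictConvex : StrictConvex ℝ (closure D)

/-- `φ ∈ C²(∂D)`: near each boundary point, `φ` is the restriction of a `C²` function. -/
def IsC2OnBoundary {n : ℕ} (D : Set (E n)) (φ : E n → ℝ) : Prop :=
  ∀ x ∈ frontier D, ∃ (U : Set (E n)) (Φ : E n → ℝ), IsOpen U ∧ x ∈ U ∧ ContDiffOn ℝ 2 Φ U ∧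
    EqOn Φ φ (U ∩ frontier D)

/-- The quadratic polynomial `½ x'Ax + b·x + c`. -/
def quadraticPoly {n : ℕ} (A : Matrix (Fin n) (Fin n) ℝ) (b : E n) (c : ℝ) (x : E n) : ℝ :=
  (1 / 2 : ℝ) * (x.ofLp ⬝ᵥ A.mulVec x.ofLp) + inner ℝ b x + c

/-- `u ∈ C⁰(ℝⁿ ∖ D)` is a viscosity solution of the exterior Dirichlet problem
`λ(D²u) ∈ ∂V` in `ℝⁿ ∖ closure D`, `u = φ` on `∂D`, `u - (½ x'Ax + b·x + c) → 0` at infinity.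
The values of `u` in `D` play no role. -/
structure SolvesExteriorDirichlet {n : ℕ} (V D : Set (E n)) (φ : E n → ℝ)
    (A : Matrix (Fin n) (Fin n) ℝ) (b : E n) (c : ℝ) (u : E n → ℝ) : Prop where
  continuousOn : ContinuousOn u Dᶜ
  viscosity : IsViscositySolution V (closure D)ᶜ u
  boundary : ∀ x ∈ frontier D, u x = φ x
  asymptotics : Tendsto (fun x => |u x - quadraticPoly A b c x|) (Bornology.cobounded (E n)) (𝓝 0)

end ExteriorDirichlet

end

noncomputable section

namespace ExteriorDirichlet

/-! ### Matrices with eigenvalues in a symmetric convex set -/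

/-! Two solutions for constants `c₁`, `c₂` agree on `∂D` and differ by about `c₁ - c₂` at infinity,
so comparison gives `u ≤ v + max 0 (c₁ - c₂)` (`SolvesExteriorDirichlet.le_add`). Solutions are thus
ordered like their constants and depend on them in a 1-Lipschitz way in the sup norm. Hence `us` is
uniformly Cauchy and monotone along a monotone subsequence of `cs`, and viscosity stability
identifies the limit.

The weight lies in `IsAdmissible.comparison`, for merely continuous sub- and supersolutions.
Convexity makes it enough to regularise the subsolution. By Schur and Birkhoff, `λ(M) ∈ closure V`
means that the diagonal of `M` in every orthonormal frame lies in `closure V`. Being a subsolution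
therefore amounts to linear inequalities `∑ νᵢ ∂²u/∂eᵢ² ≥ a` with constant `νᵢ ≥ 0`, and these
survive mollification (`FrameSubsolution.le_frameOp_mollify`). Adding `κ|x|²` to the mollification
moves its Hessian into the open set `V`, so it cannot touch a supersolution from below.

Mollification is handled by a mean value inequality. The maximum principle solves the Dirichlet
problem for polynomials on the sphere, and Hahn–Banach extends evaluation at the centre to a
functional on all continuous data. No ellipticity is needed, only `νᵢ ≥ 0` and `∑ νᵢ > 0`. -/

/-- The diagonal of the matrix `M` in the orthonormal frame `e`. -/
def frameDiag {n : ℕ} (e : OrthonormalBasis (Fin n) ℝ (E n)) (M : Matrix (Fin n) (Fin n) ℝ) :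
    E n :=
  WithLp.toLp 2 fun i => (e i).ofLp ⬝ᵥ M.mulVec (e i).ofLp

theorem frameDiag_apply {n : ℕ} (e : OrthonormalBasis (Fin n) ℝ (E n))
    (M : Matrix (Fin n) (Fin n) ℝ) (i : Fin n) :
    frameDiag e M i = (e i).ofLp ⬝ᵥ M.mulVec (e i).ofLp := rfl

theorem frameDiag_eigenvectorBasis {n : ℕ} {M : Matrix (Fin n) (Fin n) ℝ} (hM : M.IsHermitian) :
    frameDiag hM.eigenvectorBasis M = WithLp.toLp 2 hM.eigenvalues := by
  ext i
  have h1 := hM.mulVec_eigenvectorBasis i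
  have h2 : inner ℝ (hM.eigenvectorBasis i) (hM.eigenvectorBasis i) = (1 : ℝ) := by
    rw [real_inner_self_eq_norm_sq, hM.eigenvectorBasis.norm_eq_one]; norm_num
  rw [EuclideanSpace.inner_eq_star_dotProduct] at h2
  simp only [star_trivial] at h2
  rw [frameDiag_apply, h1, dotProduct_smul, h2]
  simp

theorem frameDiag_eq_sum {n : ℕ} {M : Matrix (Fin n) (Fin n) ℝ} (hM : M.IsHermitian)
    (e : OrthonormalBasis (Fin n) ℝ (E n)) (i : Fin n) :
    frameDiag e M i = ∑ j, (inner ℝ (e i) (hM.eigenvectorBasis j) : ℝ) ^ 2 * hM.eigenvalues j := by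
  set v := hM.eigenvectorBasis with hv
  have h1 : ∀ x : E n, (x.ofLp ⬝ᵥ M.mulVec x.ofLp) = inner ℝ x (M.toEuclideanLin x) := by
    intro x
    rw [EuclideanSpace.inner_eq_star_dotProduct, dotProduct_comm]
    simp [Matrix.toLpLin_apply]
  have h2 : ∀ j, M.toEuclideanLin (v j) = hM.eigenvalues j • v j := by
    intro j
    rw [Matrix.toLpLin_apply, hM.mulVec_eigenvectorBasis j]
    simp [hv]
  rw [frameDiag_apply, h1]
  conv_lhs => rw [← v.sum_repr' (e i), map_sum]
  rw [v.sum_repr', inner_sum]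
  refine Finset.sum_congr rfl fun j _ => ?_
  rw [map_smul, h2, inner_smul_right, inner_smul_right, real_inner_comm]
  ring

/-- Squared inner products of two orthonormal bases form a doubly stochastic matrix, so by Birkhoff
the diagonal is a convex combination of permuted eigenvalue vectors. -/
theorem EigenvaluesIn.frameDiag_mem {n : ℕ} {W : Set (E n)} (hW : Convex ℝ W)
    (hs : ∀ σ : Equiv.Perm (Fin n), ∀ l ∈ W, WithLp.toLp 2 (fun i => l (σ i)) ∈ W)
    {M : Matrix (Fin n) (Fin n) ℝ} (h : EigenvaluesIn M W)
    (e : OrthonormalBasis (Fin n) ℝ (E n)) : frameDiag e M ∈ W := by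
  obtain ⟨hM, hmem⟩ := h
  set v := hM.eigenvectorBasis with hv
  set P : Matrix (Fin n) (Fin n) ℝ := Matrix.of fun i j => (inner ℝ (e i) (v j) : ℝ) ^ 2 with hP
  have hPd : P ∈ doublyStochastic ℝ (Fin n) := by
    rw [mem_doublyStochastic_iff_sum]
    refine ⟨fun i j => sq_nonneg _, fun i => ?_, fun j => ?_⟩
    · have := v.sum_sq_norm_inner_left (e i)
      simpa [hP] using this
    · have := e.sum_sq_norm_inner_right (v j)
      simpa [hP] using this
  obtain ⟨w, hw0, hw1, hw2⟩ := exists_eq_sum_perm_of_mem_doublyStochastic hPd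
  have key : frameDiag e M = ∑ σ, w σ • (WithLp.toLp 2 (fun i => hM.eigenvalues (σ i)) : E n) := by
    ext i
    have : frameDiag e M i = (P.mulVec hM.eigenvalues) i := by
      rw [frameDiag_eq_sum hM, Matrix.mulVec, dotProduct]
      rfl
    rw [this, ← hw2, Matrix.sum_mulVec]
    simp only [Matrix.smul_mulVec, Matrix.permMatrix_mulVec, Finset.sum_apply, Pi.smul_apply,
      WithLp.ofLp_sum, WithLp.ofLp_smul, Function.comp]
  rw [key]
  exact hW.sum_mem (fun σ _ => hw0 σ) hw1 fun σ _ => hs σ _ hmem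

theorem eigenvaluesIn_of_frameDiag_mem {n : ℕ} {W : Set (E n)} {M : Matrix (Fin n) (Fin n) ℝ}
    (hM : M.IsHermitian) (h : ∀ e : OrthonormalBasis (Fin n) ℝ (E n), frameDiag e M ∈ W) :
    EigenvaluesIn M W :=
  ⟨hM, frameDiag_eigenvectorBasis hM ▸ h hM.eigenvectorBasis⟩

theorem continuous_frameDiag {n : ℕ} (e : OrthonormalBasis (Fin n) ℝ (E n)) :
    Continuous (frameDiag e) := by
  unfold frameDiag
  fun_prop

theorem frameDiag_add {n : ℕ} (e : OrthonormalBasis (Fin n) ℝ (E n))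
    (M N : Matrix (Fin n) (Fin n) ℝ) : frameDiag e (M + N) = frameDiag e M + frameDiag e N := by
  ext i
  simp [frameDiag_apply, Matrix.add_mulVec]

theorem dotProduct_frame_self {n : ℕ} (e : OrthonormalBasis (Fin n) ℝ (E n)) (i : Fin n) :
    (e i).ofLp ⬝ᵥ (e i).ofLp = 1 := by
  have h2 : inner ℝ (e i) (e i) = (1 : ℝ) := by
    rw [real_inner_self_eq_norm_sq, e.norm_eq_one]; norm_num
  rwa [EuclideanSpace.inner_eq_star_dotProduct, star_trivial] at h2

theorem frameDiag_smul_one {n : ℕ} (e : OrthonormalBasis (Fin n) ℝ (E n)) (t : ℝ) (i : Fin n) :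
    frameDiag e (t • (1 : Matrix (Fin n) (Fin n) ℝ)) i = t := by
  simp [frameDiag_apply, Matrix.smul_mulVec, dotProduct_frame_self]

theorem abs_frameDiag_le {n : ℕ} (e : OrthonormalBasis (Fin n) ℝ (E n))
    (M : Matrix (Fin n) (Fin n) ℝ) (i : Fin n) :
    |frameDiag e M i| ≤ ∑ k, ∑ l, |M k l| := by
  have hle : ∀ k, |(e i).ofLp k| ≤ 1 := fun k => by
    have := PiLp.norm_apply_le (e i) k
    rwa [e.norm_eq_one, Real.norm_eq_abs] at this
  rw [frameDiag_apply, dotProduct]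
  refine (Finset.abs_sum_le_sum_abs _ _).trans (Finset.sum_le_sum fun k _ => ?_)
  rw [abs_mul]
  refine (mul_le_of_le_one_left (abs_nonneg _) (hle k)).trans ?_
  rw [Matrix.mulVec, dotProduct]
  refine (Finset.abs_sum_le_sum_abs _ _).trans (Finset.sum_le_sum fun l _ => ?_)
  rw [abs_mul]
  exact mul_le_of_le_one_right (abs_nonneg _) (hle l)

/-! ### Monotonicity of admissible sets -/

theorem IsAdmissible.nonempty {n : ℕ} {V : Set (E n)} (hV : IsAdmissible V) : V.Nonempty := by
  rw [nonempty_iff_ne_empty]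
  rintro rfl
  simpa using hV.frontier_nonempty

/-- At the first exit time from `V` along `d`, the gradient of `ρ` has positive entries, so `ρ` has
positive derivative along `d`. But `ρ` passes there from positive to nonpositive values. -/
theorem IsAdmissible.add_mem {n : ℕ} {V : Set (E n)} (hV : IsAdmissible V) {v d : E n}
    (hv : v ∈ V) (hd : ∀ i, 0 ≤ d i) : v + d ∈ V := by
  by_cases hd0 : d = 0
  · simpa [hd0] using hv
  obtain ⟨i₀, hi₀⟩ : ∃ i, 0 < d i := by
    by_contra! hcon
    exact hd0 (by ext i; exact le_antisymm (hcon i) (hd i))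
  by_contra hvd
  have hcont : Continuous fun t : ℝ => v + t • d := by fun_prop
  have hT : IsCompact (Icc (0 : ℝ) 1 ∩ (fun t : ℝ => v + t • d) ⁻¹' Vᶜ) :=
    isCompact_Icc.inter_right (hV.isOpen.isClosed_compl.preimage hcont)
  obtain ⟨t₀, ⟨ht₀, ht₀V⟩, hmin⟩ := hT.exists_isLeast ⟨1, ⟨by norm_num, by norm_num⟩, by simpa⟩
  have ht₀V' : v + t₀ • d ∉ V := ht₀V
  have hpos : 0 < t₀ := ht₀.1.lt_of_ne (by rintro rfl; exact ht₀V' (by simpa using hv))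
  have hbelow : ∀ᶠ t in 𝓝[<] t₀, v + t • d ∈ V := by
    filter_upwards [Ioo_mem_nhdsLT hpos] with t ht
    by_contra hcon
    exact absurd (hmin ⟨⟨ht.1.le, ht.2.le.trans ht₀.2⟩, hcon⟩) (not_le.2 ht.2)
  have hfr : v + t₀ • d ∈ frontier V := by
    rw [hV.isOpen.frontier_eq]
    refine ⟨?_, ht₀V'⟩
    exact mem_closure_of_tendsto (hcont.continuousAt.tendsto.mono_left nhdsWithin_le_nhds) hbelow
  obtain ⟨U, ρ, hρ⟩ := hV.boundary _ hfr
  have hν := hV.normal_pos _ hfr _ ⟨U, ρ, hρ, rfl⟩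
  set g := gradient ρ (v + t₀ • d) with hg
  have hgpos : ∀ i, 0 < g i := fun i => by
    have := hν i
    simp only [PiLp.smul_apply, smul_eq_mul] at this
    exact (pos_iff_pos_of_mul_pos this).1 (inv_pos.2 (norm_pos_iff.2 hρ.gradient_ne_zero))
  have hinner : 0 < inner ℝ g d := by
    rw [PiLp.inner_apply]
    refine Finset.sum_pos' (fun i _ => ?_) ⟨i₀, Finset.mem_univ _, ?_⟩
    · simpa using mul_nonneg (hd i) (hgpos i).le
    · simpa using mul_pos hi₀ (hgpos i₀)
  have hUn : U ∈ 𝓝 (v + t₀ • d) := hρ.isOpen.mem_nhds hρ.mem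
  have hdiff : DifferentiableAt ℝ ρ (v + t₀ • d) :=
    (hρ.contDiffOn.contDiffAt hUn).differentiableAt (by norm_num)
  have hderiv : HasDerivAt (fun t : ℝ => ρ (v + t • d)) (inner ℝ g d) t₀ := by
    have h1 : HasDerivAt (fun t : ℝ => v + t • d) d t₀ := by
      simpa using ((hasDerivAt_id t₀).smul_const d).const_add v
    have h2 := hdiff.hasGradientAt.hasFDerivAt.comp_hasDerivAt t₀ h1
    rw [InnerProductSpace.toDual_apply_apply] at h2
    exact h2
  have hslope := (hasDerivAt_iff_tendsto_slope.1 hderiv).mono_left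
    (nhdsWithin_mono t₀ (show Iio t₀ ⊆ {t₀}ᶜ from fun t ht => (mem_Iio.1 ht).ne))
  have hle : inner ℝ g d ≤ 0 := by
    refine le_of_tendsto hslope ?_
    have hUt : ∀ᶠ t in 𝓝[<] t₀, v + t • d ∈ U :=
      (hcont.continuousAt.tendsto.eventually hUn).filter_mono nhdsWithin_le_nhds
    filter_upwards [hbelow, hUt, self_mem_nhdsWithin] with t htV htU htlt
    have h1 : 0 < ρ (v + t • d) := (hρ.mem_iff _ htU).1 htV
    have h2 : ρ (v + t₀ • d) ≤ 0 := not_lt.1 fun h => ht₀V' ((hρ.mem_iff _ hρ.mem).2 h)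
    rw [slope_def_field]
    exact div_nonpos_of_nonneg_of_nonpos (by linarith) (sub_nonpos.2 (le_of_lt htlt))
  linarith

/-- Strict positivity of `d` leaves room to replace `v` by a nearby point of `V` still below `v + d`
in each coordinate. -/
theorem IsAdmissible.add_mem_of_mem_closure {n : ℕ} {V : Set (E n)} (hV : IsAdmissible V)
    {v d : E n} (hv : v ∈ closure V) (hd : ∀ i, 0 < d i) : v + d ∈ V := by
  have hopen : IsOpen {z : E n | ∀ i, z i < v i + d i} := by
    simp only [ofPred_forall]
    exact isOpen_iInter_of_finite fun i => isOpen_lt (by fun_prop) continuous_const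
  obtain ⟨z, hz, hzV⟩ := mem_closure_iff.1 hv _ hopen fun i => by have := hd i; linarith
  have := hV.add_mem hzV (d := v + d - z) fun i => by
    have := hz i
    simp only [PiLp.sub_apply, PiLp.add_apply]
    linarith
  simpa using this

theorem IsAdmissible.symmetric_closure {n : ℕ} {V : Set (E n)} (hV : IsAdmissible V)
    (σ : Equiv.Perm (Fin n)) : ∀ l ∈ closure V, WithLp.toLp 2 (fun i => l (σ i)) ∈ closure V := by
  have hc : Continuous fun l : E n => (WithLp.toLp 2 (fun i => l (σ i)) : E n) := by fun_prop
  exact MapsTo.closure (fun l hl => hV.symmetric σ l hl) hc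

theorem IsAdmissible.eigenvaluesIn_closure_iff {n : ℕ} {V : Set (E n)} (hV : IsAdmissible V)
    {M : Matrix (Fin n) (Fin n) ℝ} : EigenvaluesIn M (closure V) ↔
      M.IsHermitian ∧ ∀ e : OrthonormalBasis (Fin n) ℝ (E n), frameDiag e M ∈ closure V :=
  ⟨fun h => ⟨h.1, h.frameDiag_mem hV.convex.closure hV.symmetric_closure⟩,
    fun h => eigenvaluesIn_of_frameDiag_mem h.1 h.2⟩

/-! ### Closedness of the Hessian constraints. -/

theorem isClosed_setOf_isHermitian (n : ℕ) :
    IsClosed {M : Matrix (Fin n) (Fin n) ℝ | M.IsHermitian} :=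
  isClosed_eq (by fun_prop) continuous_id

theorem IsAdmissible.isClosed_eigenvaluesIn_closure {n : ℕ} {V : Set (E n)}
    (hV : IsAdmissible V) : IsClosed {M | EigenvaluesIn M (closure V)} := by
  simp only [hV.eigenvaluesIn_closure_iff, ofPred_and, ofPred_forall]
  exact (isClosed_setOf_isHermitian n).inter
    (isClosed_iInter fun e => isClosed_closure.preimage (continuous_frameDiag e))

/-- `N` is closer than `t` to `M + t I`, so in every frame its diagonal strictly dominates that of
`M`. -/
theorem IsAdmissible.eigenvaluesIn_add_smul_one {n : ℕ} {V : Set (E n)} (hV : IsAdmissible V)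
    {M N : Matrix (Fin n) (Fin n) ℝ} {t : ℝ} (hM : EigenvaluesIn M (closure V))
    (hN : N.IsHermitian) (h : ∑ k, ∑ l, |(N - M - t • (1 : Matrix (Fin n) (Fin n) ℝ)) k l| < t) :
    EigenvaluesIn N V := by
  refine eigenvaluesIn_of_frameDiag_mem hN fun e => ?_
  have h1 := (hV.eigenvaluesIn_closure_iff.1 hM).2 e
  have h2 : N = M + (t • (1 : Matrix (Fin n) (Fin n) ℝ) +
      (N - M - t • (1 : Matrix (Fin n) (Fin n) ℝ))) := by abel
  rw [h2, frameDiag_add]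
  refine hV.add_mem_of_mem_closure h1 fun i => ?_
  rw [frameDiag_add, PiLp.add_apply, frameDiag_smul_one]
  have h3 := (abs_le.1 (abs_frameDiag_le e (N - M - t • (1 : Matrix (Fin n) (Fin n) ℝ)) i)).1
  linarith

/-- `Vᶜ` is not convex, so the frame criterion does not apply to it. Instead, if `λ(M) ∈ V` then `M
- t I` still has eigenvalues in `V` for some `t > 0`, and `IsAdmissible.eigenvaluesIn_add_smul_one`
covers all symmetric matrices near `M`. -/
theorem IsAdmissible.isClosed_eigenvaluesIn_compl {n : ℕ} {V : Set (E n)}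
    (hV : IsAdmissible V) : IsClosed {M | EigenvaluesIn M Vᶜ} := by
  have heq : {M : Matrix (Fin n) (Fin n) ℝ | EigenvaluesIn M Vᶜ} =
      {M | M.IsHermitian} ∩ {M | EigenvaluesIn M V}ᶜ := by
    ext M
    exact ⟨fun h => ⟨h.1, fun h' => h.2 h'.2⟩, fun h => ⟨h.1, fun h' => h.2 ⟨h.1, h'⟩⟩⟩
  refine isClosed_of_closure_subset fun M hM => ?_
  have hMh : M.IsHermitian :=
    (isClosed_setOf_isHermitian n).closure_subset_iff.2 (fun _ h => h.1) hM
  rw [heq]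
  refine ⟨hMh, fun hMV => ?_⟩
  set l : E n := WithLp.toLp 2 hMh.eigenvalues
  obtain ⟨t, ht, htM⟩ : ∃ t : ℝ, 0 < t ∧ EigenvaluesIn (M - t • (1 : Matrix (Fin n) (Fin n) ℝ)) V := by
    have hl : Tendsto (fun t : ℝ => l - WithLp.toLp 2 fun _ => t) (𝓝[>] 0) (𝓝 l) := by
      have : Continuous fun t : ℝ => l - (WithLp.toLp 2 fun _ => t : E n) := by fun_prop
      have h0 := (this.tendsto 0).mono_left (nhdsWithin_le_nhds (s := Ioi 0))
      have h1 : (WithLp.toLp 2 fun _ => (0 : ℝ) : E n) = 0 := rfl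
      simpa [h1] using h0
    obtain ⟨t, htV, ht⟩ := ((hl.eventually (hV.isOpen.mem_nhds hMV.2)).and
      self_mem_nhdsWithin).exists
    refine ⟨t, ht, ?_⟩
    have hherm : (M - t • (1 : Matrix (Fin n) (Fin n) ℝ)).IsHermitian :=
      hMh.sub (by simp [Matrix.IsHermitian])
    refine eigenvaluesIn_of_frameDiag_mem hherm fun e => ?_
    -- This translate of `V` is again convex and symmetric, so the frame criterion applies to `M` in
    -- it, without identifying the eigenvalues of `M - t I`.
    set W : Set (E n) := {z | z - (WithLp.toLp 2 fun _ => t) ∈ V}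
    have hW : Convex ℝ W := by
      have := hV.convex.translate_preimage_left (-(WithLp.toLp 2 fun _ => t : E n))
      simpa [W, preimage, sub_eq_add_neg] using this
    have hWs : ∀ σ : Equiv.Perm (Fin n), ∀ l ∈ W, WithLp.toLp 2 (fun i => l (σ i)) ∈ W :=
      fun σ l hl => hV.symmetric σ _ hl
    have := EigenvaluesIn.frameDiag_mem hW hWs ⟨hMh, htV⟩ e
    have hshift : frameDiag e (M - t • (1 : Matrix (Fin n) (Fin n) ℝ)) =
        frameDiag e M - WithLp.toLp 2 fun _ => t := by
      rw [sub_eq_add_neg, ← neg_smul, frameDiag_add]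
      ext i
      rw [PiLp.add_apply, frameDiag_smul_one]
      simp [sub_eq_add_neg]
    rwa [hshift]
  have hcont : Continuous fun N : Matrix (Fin n) (Fin n) ℝ =>
      ∑ k, ∑ l, |(N - (M - t • (1 : Matrix (Fin n) (Fin n) ℝ)) -
        t • (1 : Matrix (Fin n) (Fin n) ℝ)) k l| := by
    simp only [Matrix.sub_apply]
    fun_prop
  obtain ⟨N, hN, hNV⟩ := mem_closure_iff.1 hM _ (isOpen_lt hcont (continuous_const (y := t)))
    (by simpa using ht)
  exact hNV.2 (hV.eigenvaluesIn_add_smul_one ⟨htM.1, subset_closure htM.2⟩ hNV.1 hN).2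

/-! ### Constant coefficient operators and touching test functions -/

/-- The operator `∑ νᵢ ∂²/∂eᵢ²`. -/
def frameOp {n : ℕ} (ν : Fin n → ℝ) (e : OrthonormalBasis (Fin n) ℝ (E n)) (ψ : E n → ℝ)
    (x : E n) : ℝ :=
  ∑ i, ν i * fderiv ℝ (fderiv ℝ ψ) x (e i) (e i)

/-- `u` satisfies `∑ νᵢ ∂²u/∂eᵢ² ≥ c` in `O` in the viscosity sense. -/
def FrameSubsolution {n : ℕ} (ν : Fin n → ℝ) (e : OrthonormalBasis (Fin n) ℝ (E n)) (c : ℝ)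
    (u : E n → ℝ) (O : Set (E n)) : Prop :=
  ∀ x ∈ O, ∀ ψ : E n → ℝ, ContDiff ℝ 2 ψ → IsLocalMax (fun y => u y - ψ y) x → c ≤ frameOp ν e ψ x

/-! ### Second derivatives along lines. -/

section Lines

variable {F : Type*} [NormedAddCommGroup F] [NormedSpace ℝ F] {f : F → ℝ}

theorem hasDerivAt_line (hf : ContDiff ℝ 2 f) (x v : F) (t : ℝ) :
    HasDerivAt (fun t : ℝ => f (x + t • v)) (fderiv ℝ f (x + t • v) v) t := by
  have h1 : HasDerivAt (fun t : ℝ => x + t • v) v t := by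
    simpa using ((hasDerivAt_id t).smul_const v).const_add x
  exact ((hf.differentiable (by norm_num)) (x + t • v)).hasFDerivAt.comp_hasDerivAt t h1

theorem hasDerivAt_fderiv_line (hf : ContDiff ℝ 2 f) (x v : F) (t : ℝ) :
    HasDerivAt (fun t : ℝ => fderiv ℝ f (x + t • v) v) (fderiv ℝ (fderiv ℝ f) (x + t • v) v v) t := by
  have h1 : HasDerivAt (fun t : ℝ => x + t • v) v t := by
    simpa using ((hasDerivAt_id t).smul_const v).const_add x
  have hd : Differentiable ℝ (fderiv ℝ f) :=
    (hf.fderiv_right (m := 1) (by norm_num)).differentiable (by norm_num)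
  have h2 := (hd (x + t • v)).hasFDerivAt.comp_hasDerivAt t h1
  exact h2.clm_apply (hasDerivAt_const t v) |>.congr_deriv (by simp)

theorem fderiv_fderiv_eq_of_line (hf : ContDiff ℝ 2 f) {x v : F} {g : ℝ → ℝ} {a : ℝ}
    (h1 : ∀ t, HasDerivAt (fun t : ℝ => f (x + t • v)) (g t) t) (h2 : HasDerivAt g a 0) :
    fderiv ℝ (fderiv ℝ f) x v v = a := by
  have hg : g = fun t : ℝ => fderiv ℝ f (x + t • v) v :=
    funext fun t => (h1 t).unique (hasDerivAt_line hf x v t)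
  have h3 := hasDerivAt_fderiv_line hf x v 0
  rw [← hg] at h3
  simpa using h3.unique h2

theorem fderiv_fderiv_nonpos_of_isLocalMax (hf : ContDiff ℝ 2 f) {x : F} (hx : IsLocalMax f x)
    (v : F) : fderiv ℝ (fderiv ℝ f) x v v ≤ 0 := by
  by_contra! hpos
  set g : ℝ → ℝ := fun t => f (x + t • v) with hg
  have hd : deriv g = fun t : ℝ => fderiv ℝ f (x + t • v) v :=
    funext fun t => (hasDerivAt_line hf x v t).deriv
  have hdd : deriv (deriv g) 0 = fderiv ℝ (fderiv ℝ f) x v v := by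
    rw [hd, (hasDerivAt_fderiv_line hf x v 0).deriv]; simp
  have hc : Tendsto (fun t : ℝ => x + t • v) (𝓝 0) (𝓝 x) := by
    have : Continuous fun t : ℝ => x + t • v := by fun_prop
    simpa using this.tendsto 0
  have hmax : IsLocalMax g 0 := by
    filter_upwards [hc.eventually hx] with t ht
    simpa [hg] using ht
  -- A positive second derivative makes `0` a local minimum too, so `g` is locally constant and that
  -- derivative vanishes.
  have hmin : IsLocalMin g 0 := isLocalMin_of_deriv_deriv_pos (hdd ▸ hpos) hmax.deriv_eq_zero
    (hasDerivAt_line hf x v 0).continuousAt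
  have hconst : g =ᶠ[𝓝 0] fun _ => g 0 := by
    filter_upwards [hmax, hmin] with t h1 h2 using le_antisymm h1 h2
  have hzero := hconst.deriv.deriv_eq
  rw [hdd] at hzero
  simp at hzero
  linarith

theorem fderiv_fderiv_sub (hf : ContDiff ℝ 2 f) {g : F → ℝ} (hg : ContDiff ℝ 2 g) (x v : F) :
    fderiv ℝ (fderiv ℝ fun y => f y - g y) x v v =
      fderiv ℝ (fderiv ℝ f) x v v - fderiv ℝ (fderiv ℝ g) x v v :=
  fderiv_fderiv_eq_of_line (hf.sub hg)
    (fun t => (hasDerivAt_line hf x v t).sub (hasDerivAt_line hg x v t))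
    (by simpa using (hasDerivAt_fderiv_line hf x v 0).fun_sub (hasDerivAt_fderiv_line hg x v 0))

theorem fderiv_fderiv_comp_affine (hf : ContDiff ℝ 2 f) (a : ℝ) (z x v : F) :
    fderiv ℝ (fderiv ℝ fun y => f (a • (y - z))) x v v =
      a ^ 2 * fderiv ℝ (fderiv ℝ f) (a • (x - z)) v v := by
  have hl : ∀ t : ℝ, a • (x + t • v - z) = a • (x - z) + (a * t) • v := fun t => by
    rw [mul_smul]; module
  have ha : ∀ t : ℝ, HasDerivAt (fun t : ℝ => a * t) a t := fun t => by
    simpa using (hasDerivAt_id t).const_mul a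
  have hc : ContDiff ℝ 2 fun y => f (a • (y - z)) := hf.comp (by fun_prop)
  refine fderiv_fderiv_eq_of_line (g := fun t => fderiv ℝ f (a • (x - z) + (a * t) • v) v * a)
    hc (fun t => ?_) ?_
  · simp only [hl]
    exact (hasDerivAt_line hf (a • (x - z)) v (a * t)).comp t (ha t)
  · have h := ((hasDerivAt_fderiv_line hf (a • (x - z)) v (a * 0)).comp (0 : ℝ) (ha 0)).mul_const a
    refine h.congr_deriv ?_
    rw [mul_zero, zero_smul, add_zero]
    ring

end Lines

/-! ### Maximum principle and polynomial barriers. -/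

section FrameOp

variable {n : ℕ} {ν : Fin n → ℝ} {e : OrthonormalBasis (Fin n) ℝ (E n)} {c : ℝ}

theorem frameSubsolution_of_contDiff (hν : ∀ i, 0 ≤ ν i) {f : E n → ℝ} (hf : ContDiff ℝ 2 f)
    {O : Set (E n)} (h : ∀ x ∈ O, c ≤ frameOp ν e f x) : FrameSubsolution ν e c f O := by
  intro x hx ψ hψ hmax
  refine (h x hx).trans (Finset.sum_le_sum fun i _ => mul_le_mul_of_nonneg_left ?_ (hν i))
  have := fderiv_fderiv_nonpos_of_isLocalMax (hf.sub hψ) hmax (e i)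
  rw [fderiv_fderiv_sub hf hψ] at this
  linarith

/-- An interior maximum of `u - ψ` would force `c ≤ frameOp ν e ψ` there. -/
theorem FrameSubsolution.le_of_le_on_sphere {u ψ : E n → ℝ} {x : E n} {r : ℝ} (hr : 0 < r)
    (hu : FrameSubsolution ν e c u (Metric.ball x r)) (hc : ContinuousOn u (Metric.closedBall x r))
    (hψ : ContDiff ℝ 2 ψ) (hlt : ∀ y ∈ Metric.ball x r, frameOp ν e ψ y < c)
    (hle : ∀ y ∈ Metric.sphere x r, u y ≤ ψ y) : ∀ y ∈ Metric.closedBall x r, u y ≤ ψ y := by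
  obtain ⟨z, hz, hmax⟩ := (isCompact_closedBall x r).exists_isMaxOn
    ⟨x, Metric.mem_closedBall_self hr.le⟩ (hc.sub hψ.continuous.continuousOn)
  have hzs : z ∈ Metric.sphere x r := by
    by_contra hzs
    have hzb : z ∈ Metric.ball x r := by
      rw [← Metric.ball_union_sphere] at hz
      exact hz.resolve_right hzs
    have := hu z hzb ψ hψ (hmax.isLocalMax (Metric.closedBall_mem_nhds_of_mem hzb))
    exact absurd this (not_le.2 (hlt z hzb))
  intro y hy
  have h1 : u y - ψ y ≤ u z - ψ z := hmax hy
  have h2 := hle z hzs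
  linarith

/-- The polynomial `p` as a function of the coordinates in the frame `e`. -/
def polyFun (e : OrthonormalBasis (Fin n) ℝ (E n)) (p : MvPolynomial (Fin n) ℝ) (y : E n) : ℝ :=
  MvPolynomial.eval (e.repr y).ofLp p

theorem polyFun_C (a : ℝ) : polyFun e (MvPolynomial.C a) = fun _ => a := by
  ext; simp [polyFun]

theorem polyFun_add (p q : MvPolynomial (Fin n) ℝ) :
    polyFun e (p + q) = fun y => polyFun e p y + polyFun e q y := by
  ext; simp [polyFun]

theorem polyFun_mul_X (p : MvPolynomial (Fin n) ℝ) (i : Fin n) :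
    polyFun e (p * MvPolynomial.X i) = fun y => polyFun e p y * (e.repr y).ofLp i := by
  ext; simp [polyFun]

theorem contDiff_polyFun (p : MvPolynomial (Fin n) ℝ) : ContDiff ℝ 2 (polyFun e p) := by
  induction p using MvPolynomial.induction_on with
  | C a => rw [polyFun_C]; exact contDiff_const
  | add p q hp hq => rw [polyFun_add]; exact hp.add hq
  | mul_X p i hp =>
    have h : ContDiff ℝ 2 fun y : E n => (e.repr y).ofLp i := by fun_prop
    rw [polyFun_mul_X]
    exact hp.mul h

theorem hasDerivAt_polyFun (p : MvPolynomial (Fin n) ℝ) (y : E n) (i : Fin n) (t : ℝ) :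
    HasDerivAt (fun t : ℝ => polyFun e p (y + t • e i))
      (polyFun e (MvPolynomial.pderiv i p) (y + t • e i)) t := by
  induction p using MvPolynomial.induction_on with
  | C a => simpa [polyFun] using hasDerivAt_const t a
  | add p q hp hq =>
    rw [map_add, polyFun_add, polyFun_add]
    exact hp.fun_add hq
  | mul_X p j hp =>
    have h : HasDerivAt (fun t : ℝ => (e.repr (y + t • e i)).ofLp j)
        (if i = j then 1 else 0) t := by
      have h0 : ∀ t : ℝ, (e.repr (y + t • e i)).ofLp j =
          (e.repr y).ofLp j + t * (if i = j then 1 else 0) := fun t => by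
        simp [eq_comm]
      simp only [h0]
      exact (((hasDerivAt_id t).mul_const _).const_add _).congr_deriv (one_mul _)
    have h3 : polyFun e (MvPolynomial.pderiv i (p * MvPolynomial.X j)) (y + t • e i) =
        polyFun e (MvPolynomial.pderiv i p) (y + t • e i) * (e.repr (y + t • e i)).ofLp j +
          polyFun e p (y + t • e i) * (if i = j then 1 else 0) := by
      rw [MvPolynomial.pderiv_mul, MvPolynomial.pderiv_X]
      by_cases hij : i = j
      · subst hij; simp [polyFun]
      · simp [polyFun, hij, eq_comm]
    rw [h3, polyFun_mul_X]
    exact hp.fun_mul h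

/-- The operator `∑ νᵢ ∂ᵢ²` on polynomials. -/
def polyOp (ν : Fin n → ℝ) : MvPolynomial (Fin n) ℝ →ₗ[ℝ] MvPolynomial (Fin n) ℝ :=
  ∑ i, ν i • ((MvPolynomial.pderiv i).toLinearMap ∘ₗ (MvPolynomial.pderiv i).toLinearMap)

theorem polyOp_apply (p : MvPolynomial (Fin n) ℝ) :
    polyOp ν p = ∑ i, ν i • MvPolynomial.pderiv i (MvPolynomial.pderiv i p) := by
  simp [polyOp]

theorem frameOp_polyFun (p : MvPolynomial (Fin n) ℝ) (y : E n) :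
    frameOp ν e (polyFun e p) y = polyFun e (polyOp ν p) y := by
  have : ∀ i, fderiv ℝ (fderiv ℝ (polyFun e p)) y (e i) (e i) =
      polyFun e (MvPolynomial.pderiv i (MvPolynomial.pderiv i p)) y := fun i =>
    fderiv_fderiv_eq_of_line (contDiff_polyFun p) (hasDerivAt_polyFun p y i)
      (by simpa using hasDerivAt_polyFun (MvPolynomial.pderiv i p) y i 0)
  simp only [frameOp, this, polyOp_apply, polyFun, map_sum, MvPolynomial.smul_eval]

/-- The polynomial `∑ Xᵢ²`. -/
def sumSq (n : ℕ) : MvPolynomial (Fin n) ℝ := ∑ i, MvPolynomial.X i ^ 2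

theorem polyFun_sumSq (y : E n) : polyFun e (sumSq n) y = ‖y‖ ^ 2 := by
  rw [← e.repr.norm_map y, EuclideanSpace.norm_sq_eq]
  simp [polyFun, sumSq]

theorem polyOp_sumSq : polyOp ν (sumSq n) = MvPolynomial.C (2 * ∑ i, ν i) := by
  have h : ∀ i, MvPolynomial.pderiv i (sumSq n) = 2 * MvPolynomial.X i := fun i => by
    simp [sumSq, map_sum, MvPolynomial.pderiv_X, Pi.single_apply]
  have h2 : ∀ i : Fin n, MvPolynomial.pderiv i (2 * MvPolynomial.X i : MvPolynomial (Fin n) ℝ)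
      = MvPolynomial.C 2 := fun i => by
    have : (2 : MvPolynomial (Fin n) ℝ) = MvPolynomial.C 2 := (map_ofNat MvPolynomial.C 2).symm
    rw [this, MvPolynomial.pderiv_C_mul, MvPolynomial.pderiv_X_self, mul_one]
  simp only [polyOp_apply, h, h2, MvPolynomial.smul_eq_C_mul]
  simp only [← map_mul, ← map_sum, ← Finset.sum_mul]
  rw [mul_comm]

/-- Comparison of a subsolution with a polynomial solution on a ball. -/
theorem FrameSubsolution.le_poly (hs : 0 < ∑ i, ν i) {u : E n → ℝ} {x : E n} {r : ℝ} (hr : 0 < r)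
    (hu : FrameSubsolution ν e c u (Metric.ball x r)) (hc : ContinuousOn u (Metric.closedBall x r))
    {h : MvPolynomial (Fin n) ℝ} (hh : polyOp ν h = 0) {k : ℝ}
    (hle : ∀ θ : E n, ‖θ‖ = 1 → u (x + r • θ) ≤ polyFun e h θ + k) {y : E n} (hy : ‖y‖ ≤ 1) :
    u (x + r • y) ≤ polyFun e h y + k + c * r ^ 2 / (2 * ∑ i, ν i) * (‖y‖ ^ 2 - 1) := by
  set s := ∑ i, ν i
  refine le_of_forall_pos_le_add fun ε hε => ?_
  -- The barrier must have operator value strictly below `c`. Lowering it by `δ` changes the barrier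
  -- by at most `δ r² / (2s) = ε`.
  set δ : ℝ := ε * (2 * s) / r ^ 2 with hδ
  have hδ0 : 0 < δ := by positivity
  set a : ℝ := (c - δ) * r ^ 2 / (2 * s) with ha
  set P : MvPolynomial (Fin n) ℝ := h + MvPolynomial.C k + a • (sumSq n - 1) with hP
  have hPf : ∀ z, polyFun e P z = polyFun e h z + k + a * (‖z‖ ^ 2 - 1) := fun z => by
    rw [← polyFun_sumSq (e := e)]
    simp [polyFun, hP, MvPolynomial.smul_eval]
  have hPop : polyOp ν P = MvPolynomial.C (a * (2 * s)) := by
    have h1 : ∀ b : ℝ, polyOp ν (MvPolynomial.C b) = 0 := fun b => by simp [polyOp_apply]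
    have h2 := h1 1
    rw [map_one] at h2
    rw [hP, map_add, map_add, map_smul, map_sub, hh, h1, h2, polyOp_sumSq,
      MvPolynomial.smul_eq_C_mul, sub_zero, ← map_mul]
    simp [s]
  set ψ : E n → ℝ := fun z => polyFun e P (r⁻¹ • (z - x)) with hψ
  have hψc : ContDiff ℝ 2 ψ := (contDiff_polyFun P).comp (by fun_prop)
  have hop : ∀ z, frameOp ν e ψ z = c - δ := fun z => by
    have h1 : frameOp ν e ψ z = (r⁻¹) ^ 2 * frameOp ν e (polyFun e P) (r⁻¹ • (z - x)) := by
      simp only [frameOp, hψ, fderiv_fderiv_comp_affine (contDiff_polyFun P), Finset.mul_sum]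
      exact Finset.sum_congr rfl fun i _ => by ring
    rw [h1, frameOp_polyFun, hPop]
    simp only [polyFun, MvPolynomial.eval_C, ha]
    field_simp
  have hsph : ∀ z ∈ Metric.sphere x r, u z ≤ ψ z := fun z hz => by
    have hz' : ‖r⁻¹ • (z - x)‖ = 1 := by
      rw [norm_smul, ← dist_eq_norm, Metric.mem_sphere.1 hz, norm_inv, Real.norm_of_nonneg hr.le]
      field_simp
    have h1 := hle _ hz'
    rw [smul_inv_smul₀ hr.ne', add_sub_cancel] at h1
    simp only [hψ, hPf, hz']
    linarith
  have key := hu.le_of_le_on_sphere hr hc hψc (fun z _ => by rw [hop]; linarith) hsph (x + r • y)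
    (by
      rw [Metric.mem_closedBall, dist_eq_norm, add_sub_cancel_left, norm_smul,
        Real.norm_of_nonneg hr.le]
      exact mul_le_of_le_one_right hr.le hy)
  simp only [hψ, add_sub_cancel_left, inv_smul_smul₀ hr.ne', hPf] at key
  refine key.trans ?_
  have h3 : a = c * r ^ 2 / (2 * s) - ε := by
    rw [ha, hδ]; field_simp
  have h4 : ‖y‖ ^ 2 ≤ 1 := by nlinarith [norm_nonneg y]
  rw [h3]
  nlinarith [sq_nonneg ‖y‖]

/-- Maximum principle: `h` and `-h` are both subsolutions with `c = 0`, compared with the constant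
`k`. -/
theorem abs_polyFun_le (hν : ∀ i, 0 ≤ ν i) (hs : 0 < ∑ i, ν i) {h : MvPolynomial (Fin n) ℝ}
    (hh : polyOp ν h = 0) {k : ℝ} (hle : ∀ θ : E n, ‖θ‖ = 1 → |polyFun e h θ| ≤ k) {y : E n}
    (hy : ‖y‖ ≤ 1) : |polyFun e h y| ≤ k := by
  have upper : ∀ g : MvPolynomial (Fin n) ℝ, polyOp ν g = 0 →
      (∀ θ : E n, ‖θ‖ = 1 → |polyFun e g θ| ≤ k) → polyFun e g y ≤ k := fun g hg hgle => by
    have hsub : FrameSubsolution ν e 0 (polyFun e g) (Metric.ball 0 1) :=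
      frameSubsolution_of_contDiff hν (contDiff_polyFun g) fun x _ => by
        rw [frameOp_polyFun, hg]; simp [polyFun]
    have := hsub.le_poly hs one_pos (contDiff_polyFun g).continuous.continuousOn
      (h := 0) (map_zero _) (k := k)
      (fun θ hθ => by simpa [polyFun] using (le_abs_self _).trans (hgle θ hθ)) hy
    simpa [polyFun] using this
  refine abs_le.2 ⟨?_, upper h hh hle⟩
  have hneg : ∀ z, polyFun e (-h) z = -polyFun e h z := fun z => by simp [polyFun]
  have := upper (-h) (by rw [map_neg, hh, neg_zero]) fun θ hθ => by
    rw [hneg, abs_neg]; exact hle θ hθ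
  rw [hneg] at this
  linarith

end FrameOp

/-! ### The Dirichlet problem for polynomials on the unit sphere -/

theorem totalDegree_pderiv_le {σ : Type*} (p : MvPolynomial σ ℝ) (i : σ) :
    (MvPolynomial.pderiv i p).totalDegree ≤ p.totalDegree - 1 := by
  refine Finset.sup_le fun m hm => ?_
  rw [MvPolynomial.mem_support_iff, MvPolynomial.coeff_pderiv] at hm
  have h := MvPolynomial.le_totalDegree (MvPolynomial.mem_support_iff.2 (left_ne_zero_of_mul hm))
  rw [Finsupp.sum_add_index' (fun _ => rfl) (fun _ _ _ => rfl), Finsupp.sum_single_index rfl] at h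
  exact Nat.le_sub_of_add_le h

section Dirichlet

variable {n : ℕ} {ν : Fin n → ℝ} {e : OrthonormalBasis (Fin n) ℝ (E n)} {c : ℝ}

theorem totalDegree_polyOp_le (p : MvPolynomial (Fin n) ℝ) :
    (polyOp ν p).totalDegree ≤ p.totalDegree - 2 := by
  rw [polyOp_apply]
  refine MvPolynomial.totalDegree_finsetSum_le fun i _ =>
    (MvPolynomial.totalDegree_smul_le _ _).trans ?_
  have h1 := totalDegree_pderiv_le p i
  have h2 := totalDegree_pderiv_le (MvPolynomial.pderiv i p) i
  omega

theorem totalDegree_one_sub_sumSq_mul_le (q : MvPolynomial (Fin n) ℝ) :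
    ((1 - sumSq n) * q).totalDegree ≤ q.totalDegree + 2 := by
  have h : (1 - sumSq n).totalDegree ≤ 2 := by
    refine (MvPolynomial.totalDegree_sub _ _).trans (max_le (by simp) ?_)
    exact MvPolynomial.totalDegree_finsetSum_le fun i _ => by
      rw [MvPolynomial.totalDegree_X_pow]
  have := MvPolynomial.totalDegree_mul (1 - sumSq n) q
  omega

theorem eq_zero_of_polyFun_eq_zero_on_ball {p : MvPolynomial (Fin n) ℝ}
    (h : ∀ y : E n, ‖y‖ < 1 → polyFun e p y = 0) : p = 0 := by
  have hopen : IsOpen {z : Fin n → ℝ | ‖(WithLp.toLp 2 z : E n)‖ < 1} :=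
    isOpen_lt (by fun_prop) continuous_const
  obtain ⟨ε, hε, hball⟩ := Metric.isOpen_iff.1 hopen 0 (by simp)
  refine MvPolynomial.funext_set (fun _ => Metric.ball (0 : ℝ) ε)
    (fun _ => infinite_of_mem_nhds 0 (Metric.ball_mem_nhds 0 hε)) fun z hz => ?_
  have hz' : ‖(WithLp.toLp 2 z : E n)‖ < 1 := hball (by
    rw [Metric.mem_ball, dist_pi_lt_iff hε]
    exact fun i => hz i (mem_univ i))
  have := h (e.repr.symm (WithLp.toLp 2 z)) (by simpa using hz')
  simpa [polyFun] using this

theorem eq_zero_of_polyOp_eq_zero (e : OrthonormalBasis (Fin n) ℝ (E n)) (hν : ∀ i, 0 ≤ ν i)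
    (hs : 0 < ∑ i, ν i) {h : MvPolynomial (Fin n) ℝ} (hh : polyOp ν h = 0)
    (h0 : ∀ θ : E n, ‖θ‖ = 1 → polyFun e h θ = 0) : h = 0 :=
  eq_zero_of_polyFun_eq_zero_on_ball (e := e) fun y hy => abs_nonpos_iff.1
    (abs_polyFun_le hν hs hh (fun θ hθ => by simp [h0 θ hθ]) hy.le)

/-- Look for `h = p - (1 - |x|²) q`. The map `q ↦ polyOp ν ((1 - |x|²) q)` preserves polynomials of
degree at most `d`; it is injective by the maximum principle, hence surjective by finite dimension.
-/
theorem exists_polyOp_eq_zero_of_sphere (e : OrthonormalBasis (Fin n) ℝ (E n))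
    (hν : ∀ i, 0 ≤ ν i) (hs : 0 < ∑ i, ν i) (p : MvPolynomial (Fin n) ℝ) :
    ∃ h, polyOp ν h = 0 ∧ ∀ θ : E n, ‖θ‖ = 1 → polyFun e h θ = polyFun e p θ := by
  have hvan : ∀ (q : MvPolynomial (Fin n) ℝ) (θ : E n), ‖θ‖ = 1 →
      polyFun e ((1 - sumSq n) * q) θ = 0 := fun q θ hθ => by
    have := polyFun_sumSq (e := e) θ
    rw [hθ] at this
    simp only [polyFun] at this
    simp [polyFun, this]
  set d := p.totalDegree
  set P := MvPolynomial.restrictTotalDegree (Fin n) ℝ d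
  set Φ : MvPolynomial (Fin n) ℝ →ₗ[ℝ] MvPolynomial (Fin n) ℝ :=
    polyOp ν ∘ₗ LinearMap.mulLeft ℝ (1 - sumSq n)
  have hΦ : ∀ q ∈ P, Φ q ∈ P := fun q hq => by
    rw [MvPolynomial.mem_restrictTotalDegree] at hq ⊢
    have h1 := totalDegree_polyOp_le (ν := ν) ((1 - sumSq n) * q)
    have h2 := totalDegree_one_sub_sumSq_mul_le q
    change (polyOp ν ((1 - sumSq n) * q)).totalDegree ≤ d
    omega
  have hinj : Function.Injective (Φ.restrict hΦ) := by
    rw [← LinearMap.ker_eq_bot, LinearMap.ker_eq_bot']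
    intro q hq
    have h1 : polyOp ν ((1 - sumSq n) * q.1) = 0 := congrArg Subtype.val hq
    have h2 := eq_zero_of_polyOp_eq_zero e hν hs h1 (hvan q.1)
    rcases mul_eq_zero.1 h2 with h3 | h3
    · exfalso
      have := congrArg (MvPolynomial.eval (0 : Fin n → ℝ)) h3
      simp [sumSq] at this
    · exact Subtype.ext h3
  obtain ⟨q, hq⟩ := (LinearMap.injective_iff_surjective.1 hinj) ⟨polyOp ν p, by
    rw [MvPolynomial.mem_restrictTotalDegree]
    exact (totalDegree_polyOp_le p).trans (Nat.sub_le _ _)⟩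
  have hq' : polyOp ν ((1 - sumSq n) * q.1) = polyOp ν p := congrArg Subtype.val hq
  refine ⟨p - (1 - sumSq n) * q.1, by rw [map_sub, hq', sub_self], fun θ hθ => ?_⟩
  have h1 := hvan q.1 θ hθ
  simp only [polyFun] at h1 ⊢
  rw [map_sub, h1, sub_zero]

/-- Restriction of polynomials to the unit sphere. -/
def polySphere (e : OrthonormalBasis (Fin n) ℝ (E n)) :
    MvPolynomial (Fin n) ℝ →ₐ[ℝ] C(Metric.sphere (0 : E n) 1, ℝ) :=
  MvPolynomial.aeval fun i => ⟨fun θ => (e.repr θ.1).ofLp i, by fun_prop⟩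

theorem polySphere_apply (p : MvPolynomial (Fin n) ℝ) (θ : Metric.sphere (0 : E n) 1) :
    polySphere e p θ = polyFun e p θ := by
  induction p using MvPolynomial.induction_on with
  | C a => simp [polySphere, polyFun]
  | add p q hp hq => rw [map_add, ContinuousMap.add_apply, hp, hq, polyFun_add]
  | mul_X p i hp =>
    rw [map_mul, ContinuousMap.mul_apply, hp, polyFun_mul_X]
    simp [polySphere]

/-- Stone–Weierstrass approximates `f` by a polynomial, which is then replaced by the solution with
the same values on the sphere. -/
theorem exists_polyFun_near (e : OrthonormalBasis (Fin n) ℝ (E n)) (hν : ∀ i, 0 ≤ ν i)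
    (hs : 0 < ∑ i, ν i) (f : C(Metric.sphere (0 : E n) 1, ℝ)) {ε : ℝ} (hε : 0 < ε) :
    ∃ h, polyOp ν h = 0 ∧ ‖polySphere e h - f‖ < ε := by
  have hsep : (polySphere e).range.SeparatesPoints := by
    intro x y hxy
    obtain ⟨i, hi⟩ : ∃ i, (e.repr x.1).ofLp i ≠ (e.repr y.1).ofLp i := by
      by_contra! hcon
      exact hxy (Subtype.ext (e.repr.injective (PiLp.ext hcon)))
    exact ⟨_, ⟨polySphere e (MvPolynomial.X i), ⟨_, rfl⟩, rfl⟩, by simp [polySphere, hi]⟩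
  obtain ⟨⟨g, p, rfl⟩, hg⟩ :=
    ContinuousMap.exists_mem_subalgebra_near_continuousMap_of_separatesPoints _ hsep f ε hε
  obtain ⟨h, hh, hhp⟩ := exists_polyOp_eq_zero_of_sphere e hν hs p
  refine ⟨h, hh, ?_⟩
  have heq : polySphere e h = polySphere e p := by
    ext θ
    rw [polySphere_apply, polySphere_apply, hhp θ.1 (by simp)]
  rw [heq]
  exact hg

/-- A norm one functional on the continuous functions on the unit sphere that represents the value
at the center for solutions of `∑ νᵢ ∂²h/∂eᵢ² = 0`. -/
theorem exists_harmonic_functional (e : OrthonormalBasis (Fin n) ℝ (E n)) (hν : ∀ i, 0 ≤ ν i)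
    (hs : 0 < ∑ i, ν i) : ∃ I : C(Metric.sphere (0 : E n) 1, ℝ) →L[ℝ] ℝ, ‖I‖ ≤ 1 ∧
      ∀ h, polyOp ν h = 0 → I (polySphere e h) = polyFun e h 0 := by
  set R : LinearMap.ker (polyOp ν) →ₗ[ℝ] C(Metric.sphere (0 : E n) 1, ℝ) :=
    (polySphere e).toLinearMap ∘ₗ (LinearMap.ker (polyOp ν)).subtype with hR
  have hRinj : Function.Injective R := by
    rw [← LinearMap.ker_eq_bot, LinearMap.ker_eq_bot']
    intro h hh
    refine Subtype.ext (eq_zero_of_polyOp_eq_zero e hν hs h.2 fun θ hθ => ?_)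
    have := congrArg (fun f => f ⟨θ, by simpa using hθ⟩) hh
    simpa [hR, polySphere_apply] using this
  set ev : LinearMap.ker (polyOp ν) →ₗ[ℝ] ℝ :=
    (MvPolynomial.aeval (0 : Fin n → ℝ)).toLinearMap ∘ₗ (LinearMap.ker (polyOp ν)).subtype with hev
  have hev0 : ∀ h, ev h = polyFun e h.1 0 := fun h => by
    simp [hev, polyFun, MvPolynomial.aeval_eq_eval]
  -- A solution is determined by its values on the sphere, so its value at the centre is a
  -- functional of them, of norm at most one by the maximum principle.
  set T := LinearEquiv.ofInjective R hRinj
  have hbound : ∀ f : LinearMap.range R, ‖(ev ∘ₗ T.symm.toLinearMap) f‖ ≤ 1 * ‖f‖ := by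
    intro f
    obtain ⟨h, rfl⟩ := T.surjective f
    rw [LinearMap.comp_apply, LinearEquiv.coe_coe, T.symm_apply_apply, hev0, one_mul]
    refine abs_polyFun_le hν hs h.2 (fun θ hθ => ?_) (by simp)
    have := (polySphere e h.1).norm_coe_le_norm ⟨θ, by simpa using hθ⟩
    rwa [polySphere_apply] at this
  obtain ⟨I, hI, hnorm⟩ := exists_extension_norm_eq (LinearMap.range R)
    ((ev ∘ₗ T.symm.toLinearMap).mkContinuous 1 hbound)
  refine ⟨I, hnorm.trans_le (LinearMap.mkContinuous_norm_le _ zero_le_one _), fun h hh => ?_⟩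
  have h1 := hI (T ⟨h, hh⟩)
  change I (polySphere e h) = ev (T.symm (T ⟨h, hh⟩)) at h1
  rwa [T.symm_apply_apply, hev0] at h1

/-- The function `θ ↦ u (x + r θ)` on the unit sphere. -/
def sphereMap {u : E n → ℝ} (hu : Continuous u) (x : E n) (r : ℝ) :
    C(Metric.sphere (0 : E n) 1, ℝ) :=
  ⟨fun θ => u (x + r • θ.1), by fun_prop⟩

/-- The mean value inequality: compare `u` with a solution whose sphere values are within `ε / 2` of
those of `u`. The bound `‖I‖ ≤ 1` costs the other `ε / 2`. -/
theorem FrameSubsolution.le_functional (hν : ∀ i, 0 ≤ ν i) (hs : 0 < ∑ i, ν i)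
    {I : C(Metric.sphere (0 : E n) 1, ℝ) →L[ℝ] ℝ} (hI : ‖I‖ ≤ 1)
    (hIh : ∀ h, polyOp ν h = 0 → I (polySphere e h) = polyFun e h 0)
    {u : E n → ℝ} (huc : Continuous u) {x : E n} {r : ℝ} (hr : 0 < r)
    (hu : FrameSubsolution ν e c u (Metric.ball x r)) :
    u x ≤ I (sphereMap huc x r) - c * r ^ 2 / (2 * ∑ i, ν i) := by
  refine le_of_forall_pos_le_add fun ε hε => ?_
  obtain ⟨h, hh, hnear⟩ := exists_polyFun_near e hν hs (sphereMap huc x r) (half_pos hε)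
  have h1 : ∀ θ : E n, ‖θ‖ = 1 → u (x + r • θ) ≤ polyFun e h θ + ε / 2 := fun θ hθ => by
    have h2 := (polySphere e h - sphereMap huc x r).norm_coe_le_norm ⟨θ, by simpa using hθ⟩
    rw [ContinuousMap.sub_apply, polySphere_apply, Real.norm_eq_abs] at h2
    have h3 := (abs_le.1 (h2.trans hnear.le)).1
    simp only [sphereMap, ContinuousMap.coe_mk] at h3
    linarith
  have h4 := hu.le_poly hs hr huc.continuousOn hh h1 (y := 0) (by simp)
  have h5 : |I (polySphere e h - sphereMap huc x r)| ≤ ε / 2 :=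
    (I.le_of_opNorm_le hI _).trans (by rw [one_mul]; exact hnear.le)
  rw [map_sub, hIh h hh] at h5
  have h6 := (abs_le.1 h5).2
  simp only [smul_zero, add_zero, norm_zero] at h4
  linarith

/-- A `C²` function that satisfies the mean value inequality on small spheres is a subsolution. -/
theorem le_frameOp_of_le_functional (hν : ∀ i, 0 ≤ ν i) (hs : 0 < ∑ i, ν i)
    {I : C(Metric.sphere (0 : E n) 1, ℝ) →L[ℝ] ℝ} (hI : ‖I‖ ≤ 1)
    (hIh : ∀ h, polyOp ν h = 0 → I (polySphere e h) = polyFun e h 0)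
    {w : E n → ℝ} (hw : ContDiff ℝ 2 w) {x : E n} {R : ℝ} (hR : 0 < R)
    (h : ∀ r, 0 < r → r < R → w x ≤ I (sphereMap hw.continuous x r) - c * r ^ 2 / (2 * ∑ i, ν i)) :
    c ≤ frameOp ν e w x := by
  by_contra! hlt
  -- If the operator value were below `c' < c`, then `-w` would be a subsolution for `-c'` near `x`,
  -- and its mean value inequality would contradict that of `w`.
  obtain ⟨c', hc'1, hc'2⟩ := exists_between hlt
  have hcont : Continuous (frameOp ν e w) := by
    have hf : Continuous (fderiv ℝ (fderiv ℝ w)) :=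
      (hw.fderiv_right (m := 1) (by norm_num)).continuous_fderiv (by norm_num)
    unfold frameOp
    fun_prop
  obtain ⟨r₀, hr₀, hball⟩ := Metric.eventually_nhds_iff_ball.1
    (hcont.continuousAt.eventually (Iio_mem_nhds hc'1))
  set r := min r₀ (R / 2) with hr
  have hrpos : 0 < r := lt_min hr₀ (half_pos hR)
  have hnegop : ∀ y, frameOp ν e (fun z => -w z) y = -frameOp ν e w y := fun y => by
    have h0 : frameOp ν e (fun z => 0 - w z) y = -frameOp ν e w y := by
      simp only [frameOp, fderiv_fderiv_sub contDiff_const hw]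
      simp
    simpa using h0
  have hsub : FrameSubsolution ν e (-c') (fun z => -w z) (Metric.ball x r) :=
    frameSubsolution_of_contDiff hν hw.neg fun y hy => by
      rw [hnegop]
      exact neg_le_neg (hball y (Metric.ball_subset_ball (min_le_left _ _) hy)).le
  have h1 := hsub.le_functional hν hs hI hIh hw.neg.continuous hrpos
  have h2 : sphereMap hw.neg.continuous x r = -sphereMap hw.continuous x r := rfl
  rw [h2, map_neg] at h1
  have h3 := h r hrpos ((min_le_right _ _).trans_lt (half_lt_self hR))
  have h4 : 0 < (c - c') * r ^ 2 / (2 * ∑ i, ν i) := by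
    have := sub_pos.2 hc'2
    positivity
  have h5 : (c - c') * r ^ 2 / (2 * ∑ i, ν i) =
      c * r ^ 2 / (2 * ∑ i, ν i) + -c' * r ^ 2 / (2 * ∑ i, ν i) := by ring
  linarith

end Dirichlet

/-! ### Mollification of subsolutions -/

section Mollification

open MeasureTheory ContinuousLinearMap
open scoped Convolution

variable {n : ℕ} {ν : Fin n → ℝ} {e : OrthonormalBasis (Fin n) ℝ (E n)} {c : ℝ}

theorem continuous_sphereMap {u : E n → ℝ} (hu : Continuous u) (x : E n) (r : ℝ) :
    Continuous fun y => sphereMap hu (x - y) r := by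
  let G : C(E n × Metric.sphere (0 : E n) 1, ℝ) :=
    ⟨fun p => u (x - p.1 + r • p.2.1), by fun_prop⟩
  exact G.curry.continuous

/-- The mollification of `u` by a normed bump function. -/
def mollify (η : ContDiffBump (0 : E n)) (u : E n → ℝ) : E n → ℝ :=
  η.normed volume ⋆[lsmul ℝ ℝ, volume] u

theorem mollify_apply (η : ContDiffBump (0 : E n)) (u : E n → ℝ) (x : E n) :
    mollify η u x = ∫ y, η.normed volume y • u (x - y) := rfl

theorem contDiff_mollify (η : ContDiffBump (0 : E n)) {u : E n → ℝ} (hu : Continuous u) :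
    ContDiff ℝ 2 (mollify η u) :=
  η.hasCompactSupport_normed.contDiff_convolution_left (n := 2) _ η.contDiff_normed
    hu.locallyIntegrable

theorem integrable_normed_smul (η : ContDiffBump (0 : E n)) {F : Type*} [NormedAddCommGroup F]
    [NormedSpace ℝ F] {f : E n → F} (hf : Continuous f) :
    Integrable fun y => η.normed volume y • f y :=
  (η.continuous_normed.smul hf).integrable_of_hasCompactSupport
    η.hasCompactSupport_normed.smul_right

/-- Written as a Bochner integral in the space of continuous functions on the sphere, the
mollification commutes with `I`. -/
theorem sphereMap_mollify (η : ContDiffBump (0 : E n)) {u : E n → ℝ} (hu : Continuous u) (x : E n)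
    (r : ℝ) : sphereMap (contDiff_mollify η hu).continuous x r =
      ∫ y, η.normed volume y • sphereMap hu (x - y) r := by
  ext θ
  rw [ContinuousMap.integral_apply (integrable_normed_smul η (continuous_sphereMap hu x r))]
  simp only [sphereMap, ContinuousMap.coe_mk, mollify_apply, ContinuousMap.smul_apply]
  refine integral_congr_ae (Eventually.of_forall fun y => ?_)
  simp only [add_sub_right_comm]

/-- The mean value inequality uses the same `I` at every centre, so it passes to averages of
translates; for the smooth `mollify η u` it gives the pointwise inequality back. -/
theorem FrameSubsolution.le_frameOp_mollify (hν : ∀ i, 0 ≤ ν i) (hs : 0 < ∑ i, ν i)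
    (η : ContDiffBump (0 : E n)) {u : E n → ℝ} (huc : Continuous u) {x : E n} {R : ℝ}
    (hR : η.rOut < R) (hu : FrameSubsolution ν e c u (Metric.ball x R)) :
    c ≤ frameOp ν e (mollify η u) x := by
  obtain ⟨I, hI, hIh⟩ := exists_harmonic_functional e hν hs
  refine le_frameOp_of_le_functional hν hs hI hIh (contDiff_mollify η huc) (sub_pos.2 hR)
    fun r hr hrR => ?_
  set k := c * r ^ 2 / (2 * ∑ i, ν i)
  have hint := integrable_normed_smul η (continuous_sphereMap huc x r)
  rw [sphereMap_mollify η huc, ← I.integral_comp_comm hint]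
  have hk : ∫ y, η.normed volume y • k = k := η.integral_normed_smul volume k
  have hintk : Integrable fun y => η.normed volume y • k :=
    integrable_normed_smul η continuous_const
  rw [← hk, ← integral_sub (I.integrable_comp hint) hintk, mollify_apply]
  refine integral_mono (integrable_normed_smul η (by fun_prop))
    ((I.integrable_comp hint).sub hintk) fun y => ?_
  simp only [map_smul, ← smul_sub]
  by_cases hy : y ∈ Metric.ball (0 : E n) η.rOut
  · refine smul_le_smul_of_nonneg_left ?_ (η.nonneg_normed y)
    refine FrameSubsolution.le_functional hν hs hI hIh huc hr fun z hz => hu z ?_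
    -- Radii `r < R - η.rOut` keep the balls around the translated centres inside the ball of radius
    -- `R`.
    rw [Metric.mem_ball] at hz ⊢
    have h1 : dist (x - y) x < η.rOut := by simpa using hy
    have := dist_triangle z (x - y) x
    linarith
  · have : η.normed volume y = 0 := by
      rw [← Function.notMem_support, η.support_normed_eq]
      exact hy
    simp [this]

theorem dist_mollify_le (η : ContDiffBump (0 : E n)) {u : E n → ℝ} (hu : Continuous u) {x : E n}
    {ε : ℝ} (h : ∀ y ∈ Metric.ball x η.rOut, dist (u y) (u x) ≤ ε) :
    dist (mollify η u x) (u x) ≤ ε :=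
  η.dist_normed_convolution_le hu.aestronglyMeasurable h

end Mollification

/-! ### Hessians and test functions -/

section Touching

variable {n : ℕ}

theorem hessian_congr {ψ ψ' : E n → ℝ} {x : E n} (h : ψ =ᶠ[𝓝 x] ψ') :
    hessian ψ x = hessian ψ' x := by
  simp only [hessian, h.fderiv.fderiv_eq]

theorem hessian_neg (ψ : E n → ℝ) (x : E n) : hessian (fun y => -ψ y) x = -hessian ψ x := by
  have h : fderiv ℝ (fun y => -ψ y) = fun y => -fderiv ℝ ψ y := funext fun y => fderiv_fun_neg
  ext i j
  simp [hessian, h]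

theorem frameDiag_hessian (e : OrthonormalBasis (Fin n) ℝ (E n)) (ψ : E n → ℝ) (x : E n)
    (i : Fin n) : frameDiag e (hessian ψ x) i = fderiv ℝ (fderiv ℝ ψ) x (e i) (e i) := by
  have h : e i = ∑ j, (e i).ofLp j • EuclideanSpace.single j (1 : ℝ) := by
    ext k
    simp [Pi.single_apply]
  conv_rhs => rw [h]
  simp only [map_sum, map_smul, sum_apply, smul_apply,
    smul_eq_mul, frameDiag_apply, dotProduct, Matrix.mulVec, hessian, Matrix.of_apply,
    Finset.mul_sum]
  rw [Finset.sum_comm]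
  refine Finset.sum_congr rfl fun k _ => Finset.sum_congr rfl fun l _ => ?_
  ring

theorem contDiffAt_fderiv {ψ : E n → ℝ} {x : E n} (h : ContDiffAt ℝ 2 ψ x) :
    ContDiffAt ℝ 1 (fderiv ℝ ψ) x :=
  h.fderiv_right (by norm_num)

theorem continuousAt_hessian {ψ : E n → ℝ} {x : E n} (h : ContDiffAt ℝ 2 ψ x) :
    ContinuousAt (hessian ψ) x := by
  have h1 : ContinuousAt (fderiv ℝ (fderiv ℝ ψ)) x :=
    ((contDiffAt_fderiv h).fderiv_right (m := 0) (by norm_num)).continuousAt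
  refine continuousAt_pi.2 fun i => continuousAt_pi.2 fun j => ?_
  exact (h1.clm_apply continuousAt_const).clm_apply continuousAt_const

theorem hessian_add_sq {ψ : E n → ℝ} {x : E n} (h : ContDiffAt ℝ 2 ψ x) (κ : ℝ) (a : E n) :
    hessian (fun y => ψ y + κ * ‖y - a‖ ^ 2) x =
      hessian ψ x + (2 * κ) • (1 : Matrix (Fin n) (Fin n) ℝ) := by
  have hsq : ∀ y : E n, HasFDerivAt (fun y : E n => κ * ‖y - a‖ ^ 2)
      ((2 * κ) • innerSL ℝ (y - a)) y := fun y => by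
    have h1 := (((hasFDerivAt_id y).sub_const a).norm_sq).const_mul κ
    refine h1.congr_fderiv ?_
    ext z
    simp
    ring
  have h1 : fderiv ℝ (fun y => ψ y + κ * ‖y - a‖ ^ 2) =ᶠ[𝓝 x]
      fun y => fderiv ℝ ψ y + (2 * κ) • innerSL ℝ (y - a) := by
    filter_upwards [h.eventually (by norm_num)] with y hy
    exact ((hy.differentiableAt (by norm_num)).hasFDerivAt.add (hsq y)).fderiv
  have h2 : HasFDerivAt (fun y : E n => (2 * κ) • innerSL ℝ (y - a)) ((2 * κ) • innerSL ℝ) x :=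
    ((innerSL ℝ).hasFDerivAt.comp x ((hasFDerivAt_id x).sub_const a)).const_smul (2 * κ)
  have h3 := ((contDiffAt_fderiv h).differentiableAt (by norm_num)).hasFDerivAt.fun_add h2
  ext i j
  simp only [hessian, Matrix.of_apply, h1.fderiv_eq, h3.fderiv]
  have h4 : innerSL ℝ (EuclideanSpace.single i (1 : ℝ)) (EuclideanSpace.single j 1) =
      (1 : Matrix (Fin n) (Fin n) ℝ) i j := by
    rw [innerSL_apply_apply, EuclideanSpace.inner_single_left]
    simp [Matrix.one_apply]
  simp [h4]

/-- The Hessians of the `C²` functions touching `u` from above in `Ω` lie in `S`. -/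
def TouchingHessiansIn (S : Set (Matrix (Fin n) (Fin n) ℝ)) (Ω : Set (E n)) (u : E n → ℝ) : Prop :=
  ∀ x₀ ∈ Ω, ∀ ψ : E n → ℝ, ContDiffOn ℝ 2 ψ Ω → u x₀ = ψ x₀ → (∀ x ∈ Ω, u x ≤ ψ x) →
    hessian ψ x₀ ∈ S

theorem IsViscositySubsolution.touchingHessiansIn {V Ω : Set (E n)} {u : E n → ℝ}
    (h : IsViscositySubsolution V Ω u) :
    TouchingHessiansIn {M | EigenvaluesIn M (closure V)} Ω u :=
  fun x₀ hx₀ ψ hψ h0 hle => h.test x₀ hx₀ ψ hψ (sub_eq_zero.2 h0)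
    fun x hx => sub_nonpos.2 (hle x hx)

theorem IsViscositySupersolution.touchingHessiansIn_neg {V Ω : Set (E n)} {u : E n → ℝ}
    (h : IsViscositySupersolution V Ω u) :
    TouchingHessiansIn {M | EigenvaluesIn (-M) Vᶜ} Ω (fun x => -u x) := by
  intro x₀ hx₀ ψ hψ h0 hle
  change EigenvaluesIn (-hessian ψ x₀) Vᶜ
  rw [← hessian_neg]
  refine h.test x₀ hx₀ _ hψ.neg ?_ fun x hx => ?_
  · linarith
  · have := hle x hx
    linarith

/-- Local constant bounds are glued by a smooth partition of unity. The majorant serves to extend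
local test functions to all of `Ω`. -/
theorem exists_contDiff_ge {F : Set (E n)} (hF : IsClosed F) {u : E n → ℝ}
    (hu : ContinuousOn u F) : ∃ G : E n → ℝ, ContDiff ℝ 2 G ∧ ∀ x ∈ F, u x ≤ G x := by
  have hconv : ∀ x, Convex ℝ {y : ℝ | x ∈ F → u x ≤ y} := fun x => by
    intro y hy z hz a b ha hb hab hx
    exact convex_Ici (u x) (hy hx) (hz hx) ha hb hab
  obtain ⟨G, hG⟩ := exists_contMDiffMap_forall_mem_convex_of_local_const (n := 2)
    (modelWithCornersSelf ℝ (E n)) hconv fun x => by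
      by_cases hx : x ∈ F
      · refine ⟨u x + 1, ?_⟩
        have h1 := (hu x hx).eventually (Iio_mem_nhds (lt_add_one (u x)))
        filter_upwards [eventually_nhdsWithin_iff.1 h1] with y hy hyF using (hy hyF).le
      · refine ⟨0, ?_⟩
        filter_upwards [hF.isOpen_compl.mem_nhds hx] with y hy hyF using absurd hyF hy
  exact ⟨G, G.contMDiff.contDiff, fun x hx => hG x hx⟩

/-- Touching from above near a point suffices for functions with a `C²` majorant. -/
theorem TouchingHessiansIn.of_isLocalMax {S : Set (Matrix (Fin n) (Fin n) ℝ)} {Ω : Set (E n)}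
    {u : E n → ℝ} (hu : TouchingHessiansIn S Ω u) {G : E n → ℝ}
    (hG : ContDiff ℝ 2 G) (huG : ∀ x ∈ Ω, u x ≤ G x) {ψ : E n → ℝ} (hψ : ContDiffOn ℝ 2 ψ Ω)
    {x₀ : E n} (hx₀ : x₀ ∈ Ω) (hmax : IsLocalMax (fun y => u y - ψ y) x₀) :
    hessian ψ x₀ ∈ S := by
  obtain ⟨r, hr, hball⟩ := Metric.eventually_nhds_iff_ball.1 hmax
  let χ : ContDiffBump x₀ := ⟨r / 2, r, half_pos hr, half_lt_self hr⟩
  set k := u x₀ - ψ x₀ with hk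
  -- The cutoff joins `ψ + k`, which touches `u` at `x₀`, to the majorant `G` far away.
  set ψ' : E n → ℝ := fun y => χ y * (ψ y + k) + (1 - χ y) * G y with hψ'
  have hχ : ContDiff ℝ 2 χ := χ.contDiff
  have hψ'c : ContDiffOn ℝ 2 ψ' Ω :=
    (hχ.contDiffOn.mul (hψ.add contDiffOn_const)).add
      ((contDiff_const.sub hχ).mul hG).contDiffOn
  have hone : ∀ᶠ y in 𝓝 x₀, χ y = 1 := χ.eventuallyEq_one
  have hev : ψ' =ᶠ[𝓝 x₀] fun y => ψ y + k := by
    filter_upwards [hone] with y hy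
    simp [hψ', hy]
  have hH : hessian ψ' x₀ = hessian ψ x₀ := by
    rw [hessian_congr hev]
    have : fderiv ℝ (fun y => ψ y + k) = fderiv ℝ ψ := funext fun y => fderiv_add_const k
    simp only [hessian, this]
  rw [← hH]
  refine hu x₀ hx₀ ψ' hψ'c (by rw [hev.self_of_nhds, hk]; ring) fun y hy => ?_
  have h1 : u y ≤ G y := huG y hy
  have h2 : χ y * u y ≤ χ y * (ψ y + k) := by
    by_cases hyr : y ∈ Metric.ball x₀ r
    · refine mul_le_mul_of_nonneg_left ?_ χ.nonneg
      have : u y - ψ y ≤ u x₀ - ψ x₀ := hball y hyr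
      linarith
    · have : χ y = 0 := by
        rw [← Function.notMem_support, χ.support_eq]
        exact hyr
      simp [this]
  have h3 : (1 - χ y) * u y ≤ (1 - χ y) * G y :=
    mul_le_mul_of_nonneg_left h1 (sub_nonneg.2 χ.le_one)
  simp only [hψ']
  linarith

/-- Stability under uniform limits. -/
theorem TouchingHessiansIn.of_tendstoUniformlyOn {S : Set (Matrix (Fin n) (Fin n) ℝ)}
    (hS : IsClosed S) {Ω : Set (E n)} (hΩ : IsOpen Ω) {us : ℕ → E n → ℝ} {u : E n → ℝ}
    (hus : ∀ j, TouchingHessiansIn S Ω (us j)) (hc : ∀ j, ContinuousOn (us j) Ω)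
    (hG : ∀ j, ∃ G : E n → ℝ, ContDiff ℝ 2 G ∧ ∀ x ∈ Ω, us j x ≤ G x)
    (hlim : TendstoUniformlyOn us u atTop Ω) : TouchingHessiansIn S Ω u := by
  intro x₀ hx₀ ψ hψ h0 hle
  have hψat : ∀ x ∈ Ω, ContDiffAt ℝ 2 ψ x := fun x hx => hψ.contDiffAt (hΩ.mem_nhds hx)
  -- The term `κ|y - x₀|²` makes the contact at `x₀` strict, so nearby functions have contact points
  -- near `x₀`; it is removed at the end by `κ → 0`.
  have key : ∀ κ : ℝ, 0 < κ → hessian ψ x₀ + (2 * κ) • (1 : Matrix (Fin n) (Fin n) ℝ) ∈ S := by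
    intro κ hκ
    have hcont : Tendsto (fun x => hessian ψ x + (2 * κ) • (1 : Matrix (Fin n) (Fin n) ℝ)) (𝓝 x₀)
        (𝓝 (hessian ψ x₀ + (2 * κ) • (1 : Matrix (Fin n) (Fin n) ℝ))) :=
      ((continuousAt_hessian (hψat x₀ hx₀)).add continuousAt_const).tendsto
    refine hS.mem_of_frequently_of_tendsto ?_ hcont
    rw [Metric.nhds_basis_ball.frequently_iff]
    intro r₀ hr₀
    obtain ⟨r₁, hr₁, hr₁Ω⟩ := Metric.isOpen_iff.1 hΩ x₀ hx₀
    set r := min r₀ (r₁ / 2)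
    have hr : 0 < r := lt_min hr₀ (half_pos hr₁)
    have hrΩ : Metric.closedBall x₀ r ⊆ Ω :=
      (Metric.closedBall_subset_ball ((min_le_right _ _).trans_lt (half_lt_self hr₁))).trans hr₁Ω
    set ψκ : E n → ℝ := fun y => ψ y + κ * ‖y - x₀‖ ^ 2 with hψκ
    have hψκc : ContDiffOn ℝ 2 ψκ Ω := by
      have : ContDiff ℝ 2 fun y : E n => κ * ‖y - x₀‖ ^ 2 :=
        contDiff_const.mul ((contDiff_id.sub contDiff_const).norm_sq ℝ)
      exact hψ.add this.contDiffOn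
    -- With error below `κr²/4`, `us j - ψκ` exceeds `-κr²/4` at the centre and is below `-3κr²/4`
    -- on the sphere, so its maximum is interior.
    obtain ⟨j, hj⟩ := (Metric.tendstoUniformlyOn_iff.1 hlim (κ * r ^ 2 / 4) (by positivity)).exists
    obtain ⟨z, hz, hmax⟩ := (isCompact_closedBall x₀ r).exists_isMaxOn
      ⟨x₀, Metric.mem_closedBall_self hr.le⟩ (((hc j).sub hψκc.continuousOn).mono hrΩ)
    have hzb : z ∈ Metric.ball x₀ r := by
      by_contra hzb
      have hzr : ‖z - x₀‖ = r := by
        rw [← dist_eq_norm]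
        exact le_antisymm hz (not_lt.1 hzb)
      have h1 : us j x₀ - ψκ x₀ ≤ us j z - ψκ z := hmax (Metric.mem_closedBall_self hr.le)
      have h2 := (abs_lt.1 (hj x₀ hx₀)).2
      have h3 := (abs_lt.1 (hj z (hrΩ hz))).1
      have h4 := hle z (hrΩ hz)
      simp only [hψκ, hzr, sub_self, norm_zero] at h1
      have h5 : 0 < κ * r ^ 2 := by positivity
      linarith
    have hzΩ := hrΩ hz
    obtain ⟨G, hGc, hGle⟩ := hG j
    have := (hus j).of_isLocalMax hGc hGle hψκc hzΩ
      (hmax.isLocalMax (Metric.closedBall_mem_nhds_of_mem hzb))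
    rw [hψκ, hessian_add_sq (hψat z hzΩ)] at this
    exact ⟨z, Metric.ball_subset_ball (min_le_left _ _) hzb, this⟩
  have hlim0 : Tendsto (fun κ : ℝ => hessian ψ x₀ + (2 * κ) • (1 : Matrix (Fin n) (Fin n) ℝ))
      (𝓝[>] 0) (𝓝 (hessian ψ x₀)) := by
    have : Continuous fun κ : ℝ => hessian ψ x₀ + (2 * κ) • (1 : Matrix (Fin n) (Fin n) ℝ) := by
      fun_prop
    simpa using (this.tendsto 0).mono_left nhdsWithin_le_nhds
  exact hS.mem_of_tendsto hlim0 (eventually_nhdsWithin_of_forall key)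

end Touching

/-! ### The comparison principle -/

section Comparison

variable {n : ℕ} {V : Set (E n)}

theorem continuousLinearMap_apply_eq_sum (f : E n →L[ℝ] ℝ) (z : E n) :
    f z = ∑ i, f (EuclideanSpace.single i 1) * z i := by
  have h : z = ∑ j, z j • EuclideanSpace.single j (1 : ℝ) := by
    ext k
    simp [Pi.single_apply]
  conv_lhs => rw [h]
  simp [mul_comm]

/-- Mollifications of viscosity subsolutions are classical subsolutions. -/
theorem IsAdmissible.eigenvaluesIn_hessian_mollify (hV : IsAdmissible V) {Ω : Set (E n)}
    {u : E n → ℝ} (hu : IsViscositySubsolution V Ω u)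
    {G : E n → ℝ} (hG : ContDiff ℝ 2 G) (huG : ∀ x ∈ Ω, u x ≤ G x) {v : E n → ℝ}
    (hv : Continuous v) (η : ContDiffBump (0 : E n)) {x : E n} {R : ℝ} (hR : η.rOut < R)
    (hball : Metric.ball x R ⊆ Ω) (huv : EqOn v u (Metric.ball x R)) :
    EigenvaluesIn (hessian (mollify η v) x) (closure V) := by
  refine hV.eigenvaluesIn_closure_iff.2 ⟨hessian_isHermitian isOpen_univ
    (contDiff_mollify η hv).contDiffOn (mem_univ x), fun e => ?_⟩
  by_contra hnot
  -- A frame diagonal outside `closure V` is strictly separated from it, and the coefficients of the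
  -- separating functional define a linear operator for which `u` is a subsolution.
  obtain ⟨f, a, hfa, haf⟩ :=
    geometric_hahn_banach_point_closed hV.convex.closure isClosed_closure hnot
  set ν : Fin n → ℝ := fun i => f (EuclideanSpace.single i 1) with hνdef
  obtain ⟨z, hz⟩ := hV.nonempty
  -- `f` is bounded below on `V`, which is stable under adding multiples `t ≥ 0` of the basis
  -- vectors.
  have hν : ∀ i, 0 ≤ ν i := fun i => by
    by_contra! hneg
    obtain ⟨t, ht⟩ := exists_nat_gt ((f z - a) / -ν i)
    have h1 := haf _ (subset_closure (hV.add_mem hz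
      (d := (t : ℝ) • EuclideanSpace.single i (1 : ℝ)) fun j => by
        by_cases hij : j = i <;> simp [hij]))
    rw [map_add, map_smul, smul_eq_mul] at h1
    rw [div_lt_iff₀ (neg_pos.2 hneg)] at ht
    change a < f z + t * ν i at h1
    linarith
  have hs : 0 < ∑ i, ν i := by
    refine (Finset.sum_nonneg fun i _ => hν i).lt_of_ne fun h0 => ?_
    have hzero : ∀ y, f y = 0 := fun y => by
      have := (Finset.sum_eq_zero_iff_of_nonneg fun i _ => hν i).1 h0.symm
      rw [continuousLinearMap_apply_eq_sum]
      exact Finset.sum_eq_zero fun i hi => mul_eq_zero_of_left (this i hi) _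
    have h1 := haf z (subset_closure hz)
    rw [hzero] at hfa h1
    linarith
  have hop : ∀ (ψ : E n → ℝ) (y : E n), frameOp ν e ψ y = f (frameDiag e (hessian ψ y)) :=
    fun ψ y => by
      rw [continuousLinearMap_apply_eq_sum, frameOp]
      simp only [frameDiag_hessian, hνdef]
  have hsub : FrameSubsolution ν e a v (Metric.ball x R) := by
    intro y hy ψ hψ hmax
    have hev : (fun z => v z - ψ z) =ᶠ[𝓝 y] fun z => u z - ψ z := by
      filter_upwards [Metric.isOpen_ball.mem_nhds hy] with z hz
      rw [huv hz]
    have hmem : EigenvaluesIn (hessian ψ y) (closure V) :=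
      hu.touchingHessiansIn.of_isLocalMax hG huG hψ.contDiffOn (hball hy) (hmax.congr hev)
    rw [hop]
    exact (haf _ ((hV.eigenvaluesIn_closure_iff.1 hmem).2 e)).le
  have h1 := hsub.le_frameOp_mollify hν hs η hv hR
  rw [hop] at h1
  linarith

/-- `F \ Ω` plays the role of the boundary. Points where the excess `u - v - k` is at least half of
a positive value `m` form a compact subset of `Ω`, and small perturbations of `u` keep the maximum
there. -/
theorem IsAdmissible.comparison (hV : IsAdmissible V) {F Ω : Set (E n)} (hF : IsClosed F)
    (hΩ : IsOpen Ω) (hΩF : Ω ⊆ F) {u v : E n → ℝ} (huF : ContinuousOn u F)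
    (hvF : ContinuousOn v F) (hu : IsViscositySubsolution V Ω u)
    (hv : IsViscositySupersolution V Ω v) {k : ℝ} (hb : ∀ x ∈ F \ Ω, u x ≤ v x + k)
    (hinf : ∀ ε > 0, ∀ᶠ x in Bornology.cobounded (E n), u x ≤ v x + k + ε) :
    ∀ x ∈ F, u x ≤ v x + k := by
  by_contra! hcon
  obtain ⟨x₁, hx₁F, hx₁⟩ := hcon
  obtain ⟨m, hm⟩ : ∃ m, m = u x₁ - v x₁ - k := ⟨_, rfl⟩
  have hmpos : 0 < m := by linarith
  set K : Set (E n) := F ∩ (fun x => u x - v x - k) ⁻¹' Ici (m / 2) with hK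
  have hKclosed : IsClosed K :=
    ((huF.sub hvF).sub continuousOn_const).preimage_isClosed_of_isClosed hF isClosed_Ici
  have hKbdd : Bornology.IsBounded K := by
    rw [Bornology.isBounded_def]
    filter_upwards [hinf (m / 4) (by positivity)] with x hx hxK
    have : m / 2 ≤ u x - v x - k := hxK.2
    linarith
  have hKcomp : IsCompact K := Metric.isCompact_of_isClosed_isBounded hKclosed hKbdd
  have hx₁K : x₁ ∈ K := ⟨hx₁F, by rw [mem_preimage, ← hm]; exact half_le_self hmpos.le⟩
  have hKΩ : K ⊆ Ω := fun x hx => by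
    by_contra hxΩ
    have h1 := hb x ⟨hx.1, hxΩ⟩
    have h2 : m / 2 ≤ u x - v x - k := hx.2
    linarith
  obtain ⟨δ, hδ, hδΩ⟩ := hKcomp.exists_cthickening_subset_open hΩ hKΩ
  set N := Metric.cthickening δ K
  have hNcomp : IsCompact N := hKcomp.cthickening
  obtain ⟨B, hB, hNB⟩ := hNcomp.isBounded.exists_pos_norm_le
  have huN : ContinuousOn u N := huF.mono (hδΩ.trans hΩF)
  -- Tietze extension: mollification needs a function continuous on the whole space.
  obtain ⟨w₀, hw₀⟩ := ContinuousMap.exists_restrict_eq hNcomp.isClosed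
    (⟨N.domRestrict u, huN.domRestrict⟩ : C(N, ℝ))
  have hw₀u : EqOn w₀ u N := fun x hx => congrArg (fun f : C(N, ℝ) => f ⟨x, hx⟩) hw₀
  obtain ⟨δ', hδ', huc⟩ := Metric.uniformContinuousOn_iff.1
    (hNcomp.uniformContinuousOn_of_continuous huN) (m / 16) (by positivity)
  set ρ := min (δ / 4) δ'
  have hρ : 0 < ρ := lt_min (by positivity) hδ'
  let η : ContDiffBump (0 : E n) := ⟨ρ / 2, ρ, half_pos hρ, half_lt_self hρ⟩
  set w := mollify η w₀ with hw
  have hwc : ContDiff ℝ 2 w := contDiff_mollify η w₀.continuous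
  -- Mollification at points of this half-size neighbourhood only sees values in `N`, where `w₀ =
  -- u`.
  set N' := Metric.cthickening (δ / 2) K
  have hN'N : N' ⊆ N := Metric.cthickening_mono (by linarith) K
  have hN'comp : IsCompact N' := hKcomp.cthickening
  have hballN : ∀ x ∈ N', Metric.ball x (δ / 2) ⊆ N := fun x hx y hy => by
    have h1 : y ∈ Metric.cthickening (δ / 2) N' := Metric.mem_cthickening_of_dist_le y x _ _ hx
      (Metric.mem_ball.1 hy).le
    have h2 := Metric.cthickening_cthickening_subset (by positivity) (by positivity) K h1
    rwa [add_halves] at h2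
  have hρδ : ρ < δ / 2 := (min_le_left _ _).trans_lt (by linarith)
  have hclose : ∀ x ∈ N', |w x - u x| ≤ m / 16 := fun x hx => by
    rw [← hw₀u (hN'N hx), ← Real.dist_eq]
    refine dist_mollify_le η w₀.continuous fun y hy => ?_
    have hyN : y ∈ N := hballN x hx (Metric.ball_subset_ball hρδ.le hy)
    rw [hw₀u hyN, hw₀u (hN'N hx)]
    exact (huc y hyN x (hN'N hx) ((Metric.mem_ball.1 hy).trans_le (min_le_right _ _))).le
  -- Mollification error and quadratic term are each at most `m/16` on `N'`, so the excess at the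
  -- perturbed maximum is at least `m - 3m/16 > m/2`.
  set κ := m / (16 * B ^ 2) with hκ
  have hκpos : 0 < κ := by positivity
  set ψ : E n → ℝ := fun y => w y + κ * ‖y - 0‖ ^ 2 with hψ
  have hψc : ContDiff ℝ 2 ψ :=
    hwc.add (contDiff_const.mul ((contDiff_id.sub contDiff_const).norm_sq ℝ))
  have hκB : ∀ x ∈ N', κ * ‖x - 0‖ ^ 2 ≤ m / 16 := fun x hx => by
    rw [sub_zero]
    have h1 : ‖x‖ ^ 2 ≤ B ^ 2 := pow_le_pow_left₀ (norm_nonneg x) (hNB x (hN'N hx)) 2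
    calc κ * ‖x‖ ^ 2 ≤ κ * B ^ 2 := by gcongr
      _ = m / 16 := by rw [hκ]; field_simp
  have hKN' : K ⊆ N' := Metric.self_subset_cthickening K
  have hN'Ω : N' ⊆ Ω := hN'N.trans hδΩ
  obtain ⟨z, hzN', hzmax⟩ := hN'comp.exists_isMaxOn ⟨x₁, hKN' hx₁K⟩
    (hψc.continuous.continuousOn.sub (hvF.mono (hN'Ω.trans hΩF)))
  have hz1 : ψ x₁ - v x₁ ≤ ψ z - v z := hzmax (hKN' hx₁K)
  have hzK : z ∈ K := by
    refine ⟨hΩF (hN'Ω hzN'), ?_⟩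
    rw [mem_preimage, mem_Ici]
    have h1 := (abs_le.1 (hclose x₁ (hKN' hx₁K))).1
    have h2 := (abs_le.1 (hclose z hzN')).2
    have h3 := hκB z hzN'
    have h4 : 0 ≤ κ * ‖x₁ - 0‖ ^ 2 := by positivity
    simp only [hψ] at hz1
    linarith
  have hN'nhds : N' ∈ 𝓝 z := mem_of_superset
    (Metric.isOpen_thickening.mem_nhds (Metric.self_subset_thickening (half_pos hδ) K hzK))
    (Metric.thickening_subset_cthickening _ K)
  have hzΩ : z ∈ Ω := hKΩ hzK
  obtain ⟨G, hGc, hGle⟩ := exists_contDiff_ge hF huF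
  obtain ⟨H, hHc, hHle⟩ := exists_contDiff_ge hF hvF.neg
  have hwz : EigenvaluesIn (hessian w z) (closure V) :=
    hV.eigenvaluesIn_hessian_mollify hu hGc (fun x hx => hGle x (hΩF hx)) w₀.continuous η
      (R := δ / 2) hρδ ((hballN z hzN').trans hδΩ) (hw₀u.mono (hballN z hzN'))
  have hmaxneg : IsLocalMax (fun y => -v y - -ψ y) z := by
    have := hzmax.isLocalMax hN'nhds
    filter_upwards [this] with y hy
    have hy' : ψ y - v y ≤ ψ z - v z := hy
    linarith
  have hψz : EigenvaluesIn (hessian ψ z) Vᶜ := by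
    have h1 : EigenvaluesIn (-hessian (fun y => -ψ y) z) Vᶜ :=
      hv.touchingHessiansIn_neg.of_isLocalMax hHc (fun x hx => hHle x (hΩF hx))
        hψc.neg.contDiffOn hzΩ hmaxneg
    rwa [hessian_neg, neg_neg] at h1
  -- The quadratic term adds `2κ I` to a Hessian with eigenvalues in `closure V`, against the
  -- supersolution property of `v`.
  have hψV : EigenvaluesIn (hessian ψ z) V := by
    refine hV.eigenvaluesIn_add_smul_one (t := 2 * κ) hwz hψz.1 ?_
    rw [hψ, hessian_add_sq hwc.contDiffAt]
    simpa using hκpos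
  exact hψz.2 hψV.2

end Comparison

/-! ### Solutions of the exterior problem -/

section Exterior

variable {n : ℕ} {V D : Set (E n)} {φ : E n → ℝ} {A : Matrix (Fin n) (Fin n) ℝ} {b : E n}

theorem SolvesExteriorDirichlet.le_add (hV : IsAdmissible V) (hD : IsOpen D) {c₁ c₂ : ℝ}
    {u v : E n → ℝ} (hu : SolvesExteriorDirichlet V D φ A b c₁ u)
    (hv : SolvesExteriorDirichlet V D φ A b c₂ v) :
    ∀ x ∈ Dᶜ, u x ≤ v x + max 0 (c₁ - c₂) := by
  refine hV.comparison hD.isClosed_compl isClosed_closure.isOpen_compl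
    (compl_subset_compl.2 subset_closure) hu.continuousOn hv.continuousOn hu.viscosity.sub
    hv.viscosity.super (fun x hx => ?_) fun ε hε => ?_
  · have hfr : x ∈ frontier D := by
      rw [hD.frontier_eq]
      exact ⟨not_not.1 hx.2, hx.1⟩
    rw [hu.boundary x hfr, hv.boundary x hfr]
    exact le_add_of_nonneg_right (le_max_left _ _)
  · filter_upwards [hu.asymptotics.eventually (Iio_mem_nhds (half_pos hε)),
      hv.asymptotics.eventually (Iio_mem_nhds (half_pos hε))] with x h1 h2
    have h3 := (abs_lt.1 h1).2
    have h4 := (abs_lt.1 h2).1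
    have h5 := le_max_right 0 (c₁ - c₂)
    simp only [quadraticPoly] at h3 h4
    linarith

theorem IsViscositySolution.of_tendstoUniformlyOn (hV : IsAdmissible V) {F Ω : Set (E n)}
    (hF : IsClosed F) (hΩ : IsOpen Ω) (hΩF : Ω ⊆ F) {us : ℕ → E n → ℝ} {u : E n → ℝ}
    (hus : ∀ j, IsViscositySolution V Ω (us j)) (hc : ∀ j, ContinuousOn (us j) F)
    (hlim : TendstoUniformlyOn us u atTop Ω) : IsViscositySolution V Ω u := by
  have hcont : ContinuousOn u Ω :=
    hlim.continuousOn (Frequently.of_forall fun j => (hus j).continuousOn)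
  refine ⟨hcont, ⟨hcont.upperSemicontinuousOn, fun x₀ hx₀ ψ hψ h0 hle => ?_⟩,
    ⟨hcont.lowerSemicontinuousOn, fun x₀ hx₀ ψ hψ h0 hle => ?_⟩⟩
  · refine TouchingHessiansIn.of_tendstoUniformlyOn hV.isClosed_eigenvaluesIn_closure hΩ
      (fun j => (hus j).sub.touchingHessiansIn) (fun j => (hus j).continuousOn) (fun j => ?_) hlim
      x₀ hx₀ ψ hψ (sub_eq_zero.1 h0) fun x hx => sub_nonpos.1 (hle x hx)
    obtain ⟨G, hG, hle⟩ := exists_contDiff_ge hF (hc j)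
    exact ⟨G, hG, fun x hx => hle x (hΩF hx)⟩
  · have hlim' : TendstoUniformlyOn (fun j x => -us j x) (fun x => -u x) atTop Ω := by
      rw [Metric.tendstoUniformlyOn_iff] at hlim ⊢
      simpa using hlim
    have h1 : EigenvaluesIn (-hessian (fun y => -ψ y) x₀) Vᶜ := by
      refine TouchingHessiansIn.of_tendstoUniformlyOn
        (S := {M | EigenvaluesIn (-M) Vᶜ}) (hV.isClosed_eigenvaluesIn_compl.preimage continuous_neg)
        hΩ (fun j => (hus j).super.touchingHessiansIn_neg) (fun j => (hus j).continuousOn.neg)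
        (fun j => ?_) hlim' x₀ hx₀ _ hψ.neg ?_ fun x hx => ?_
      · obtain ⟨G, hG, hle⟩ := exists_contDiff_ge hF (hc j).neg
        exact ⟨G, hG, fun x hx => hle x (hΩF hx)⟩
      · linarith
      · have := hle x hx
        linarith
    rwa [hessian_neg, neg_neg] at h1

theorem SolvesExteriorDirichlet.of_tendstoUniformlyOn (hV : IsAdmissible V) (hD : IsOpen D)
    (hDb : Bornology.IsBounded D) {c : ℝ} {cs : ℕ → ℝ} (hcs : Tendsto cs atTop (𝓝 c))
    {us : ℕ → E n → ℝ} {u : E n → ℝ} (hus : ∀ j, SolvesExteriorDirichlet V D φ A b (cs j) (us j))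
    (hlim : TendstoUniformlyOn us u atTop Dᶜ) : SolvesExteriorDirichlet V D φ A b c u where
  continuousOn := hlim.continuousOn (Frequently.of_forall fun j => (hus j).continuousOn)
  viscosity := IsViscositySolution.of_tendstoUniformlyOn hV hD.isClosed_compl
    isClosed_closure.isOpen_compl (compl_subset_compl.2 subset_closure)
    (fun j => (hus j).viscosity) (fun j => (hus j).continuousOn)
    (hlim.mono (compl_subset_compl.2 subset_closure))
  boundary x hx := by
    have hxD : x ∈ Dᶜ := by
      rw [hD.frontier_eq] at hx
      exact hx.2
    refine tendsto_nhds_unique (hlim.tendsto_at hxD) ?_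
    simp only [(hus _).boundary x hx, tendsto_const_nhds]
  asymptotics := by
    rw [Metric.tendsto_nhds]
    intro ε hε
    -- Convergence is uniform up to infinity, so one index `j` controls the asymptotics of the
    -- limit.
    obtain ⟨j, hj1, hj2⟩ := ((Metric.tendstoUniformlyOn_iff.1 hlim (ε / 3) (by positivity)).and
      (Metric.tendsto_nhds.1 hcs (ε / 3) (by positivity))).exists
    have hDc : ∀ᶠ x in Bornology.cobounded (E n), x ∈ Dᶜ := Bornology.isBounded_def.1 hDb
    filter_upwards [hDc, (hus j).asymptotics.eventually
      (Iio_mem_nhds (show 0 < ε / 3 by positivity))] with x hxD hx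
    have h1 := abs_lt.1 (hj1 x hxD)
    have h2 := abs_lt.1 hj2
    have h3 := abs_lt.1 hx
    rw [Real.dist_eq, sub_zero, abs_abs, abs_lt]
    simp only [quadraticPoly] at h3 ⊢
    constructor <;> linarith [h1.1, h1.2, h2.1, h2.2, h3.1, h3.2]

/-- Comparison in both directions bounds `|us i - us j|` by `|cs i - cs j|`, so the whole sequence
converges. -/
theorem exists_tendstoUniformlyOn (hV : IsAdmissible V) (hD : IsOpen D) {c : ℝ} {cs : ℕ → ℝ}
    (hcs : Tendsto cs atTop (𝓝 c)) {us : ℕ → E n → ℝ}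
    (hus : ∀ j, SolvesExteriorDirichlet V D φ A b (cs j) (us j)) :
    ∃ u, TendstoUniformlyOn us u atTop Dᶜ := by
  have hdist : ∀ x ∈ Dᶜ, ∀ i j, dist (us i x) (us j x) ≤ dist (cs i) (cs j) := fun x hx i j => by
    have h1 := (hus i).le_add hV hD (hus j) x hx
    have h2 := (hus j).le_add hV hD (hus i) x hx
    have h3 : max 0 (cs i - cs j) ≤ |cs i - cs j| := max_le (abs_nonneg _) (le_abs_self _)
    have h4 : max 0 (cs j - cs i) ≤ |cs i - cs j| :=
      max_le (abs_nonneg _) (by rw [abs_sub_comm]; exact le_abs_self _)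
    rw [Real.dist_eq, Real.dist_eq, abs_le]
    constructor <;> linarith
  have hcauchy : ∀ x ∈ Dᶜ, ∃ l, Tendsto (fun j => us j x) atTop (𝓝 l) := fun x hx => by
    refine cauchySeq_tendsto_of_complete (Metric.cauchySeq_iff.2 fun ε hε => ?_)
    obtain ⟨N, hN⟩ := Metric.cauchySeq_iff.1 hcs.cauchySeq ε hε
    exact ⟨N, fun i hi j hj => (hdist x hx i j).trans_lt (hN i hi j hj)⟩
  choose! u hu using hcauchy
  refine ⟨u, Metric.tendstoUniformlyOn_iff.2 fun ε hε => ?_⟩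
  filter_upwards [Metric.tendsto_nhds.1 hcs ε hε] with j hj x hx
  have h1 : dist (u x) (us j x) ≤ dist c (cs j) :=
    le_of_tendsto_of_tendsto ((hu x hx).dist tendsto_const_nhds) (hcs.dist tendsto_const_nhds)
      (Eventually.of_forall fun i => hdist x hx i j)
  rw [dist_comm c] at h1
  exact h1.trans_lt hj

end Exterior

end ExteriorDirichlet

end

theorem mainTheorem5 (n : ℕ) (hn : 3 ≤ n)
    (V : Set (ExteriorDirichlet.E n)) (hV : ExteriorDirichlet.IsAdmissible V)
    (D : Set (ExteriorDirichlet.E n)) (hD : ExteriorDirichlet.IsSmoothStrictlyConvexDomain D)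
    (φ : ExteriorDirichlet.E n → ℝ) (hφ : ExteriorDirichlet.IsC2OnBoundary D φ)
    (A : Matrix (Fin n) (Fin n) ℝ) (hA : A.PosDef)
    (hAV : ExteriorDirichlet.EigenvaluesIn A (frontier V))
    (b : ExteriorDirichlet.E n) (c : ℝ) (cs : ℕ → ℝ) (hcs : Tendsto cs atTop (𝓝 c))
    (us : ℕ → ExteriorDirichlet.E n → ℝ)
    (hus : ∀ j, ExteriorDirichlet.SolvesExteriorDirichlet V D φ A b (cs j) (us j)) :
    ∃ u : ExteriorDirichlet.E n → ℝ,
      ExteriorDirichlet.SolvesExteriorDirichlet V D φ A b c u ∧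
      ∃ s : ℕ → ℕ, StrictMono s ∧
        ((∀ x ∈ Dᶜ, Monotone fun k => us (s k) x) ∨
          (∀ x ∈ Dᶜ, Antitone fun k => us (s k) x)) ∧
        TendstoUniformlyOn (fun k => us (s k)) u atTop Dᶜ := by
  have hlip := fun i j => (hus i).le_add hV hD.isOpen (hus j)
  have hmono : ∀ i j, cs i ≤ cs j → ∀ x ∈ Dᶜ, us i x ≤ us j x := fun i j hij x hx => by
    simpa [max_eq_left (sub_nonpos.2 hij)] using hlip i j x hx
  obtain ⟨u, hlim⟩ := ExteriorDirichlet.exists_tendstoUniformlyOn hV hD.isOpen hcs hus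
  refine ⟨u, .of_tendstoUniformlyOn hV hD.isOpen hD.isBounded hcs hus hlim, ?_⟩
  -- Ramsey: some subsequence of `cs` is nondecreasing or strictly decreasing, and `hmono` transfers
  -- the order to `us`. The alternatives speak only of `k < l`, hence the separate case `k = l`
  -- below.
  obtain ⟨s, hs⟩ := exists_increasing_or_nonincreasing_subseq (· ≤ ·) cs
  refine ⟨s, s.strictMono, ?_, fun U hU => s.strictMono.tendsto_atTop.eventually (hlim U hU)⟩
  rcases hs with hs | hs
  · exact .inl fun x hx k l hkl => hmono _ _ (hkl.lt_or_eq.elim (hs k l) fun h => h ▸ le_rfl) x hx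
  · exact .inr fun x hx k l hkl =>
      hmono _ _ (hkl.lt_or_eq.elim (fun h => (not_le.1 (hs k l h)).le) fun h => h ▸ le_rfl) x hx
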